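/- Let $d\ge 1$ and let $\mathbb D^d=\{z=(z^1,\dots,z^d)\in\mathbb C^d : |z^i|<1 \text{ for all } i\}$. Let $(r_n)_{n\in\mathbb N}$ be a (deterministic) sequence in $[0,1)^d$, and let $\theta_n=(\theta_n^1,\dots,\theta_n^d)$, $n\in\mathbb N$, be independent random vectors on a probability space $(\Omega,\mathcal A,\mathbb P)$, each uniformly distributed on $[0,2\pi)^d$ (that is, on the torus $\mathbb T^d$). Let $\Lambda=(\lambda_n)_{n\in\mathbb N}$ be the random sequence in $\mathbb D^d$ given by $$\lambda_n=\left(r_n^1e^{i\theta_n^1},\dots,r_n^de^{i\theta_n^d}\right).$$ For $m=(m_1,\dots,m_d)\in\mathbb N^d$ (with $0\in\mathbb N$) put $|m|=m_1+\dots+m_d$ and let $$N_m=\#\{n\in\mathbb N : 1-2^{-m_i}\le |\lambda_n^i|<1-2^{-(m_i+1)},\ i=1,\dots,d\}\in\{0,1,2,\dots,\infty\},$$ which is deterministic since $|\lambda_n^i|=r_n^i$. Let $$\rho_G(z,w)=\max_{1\le i\le d}\left|\frac{z^i-w^i}{1-\overline{z^i}\,w^i}\right|$$ be the Gleason distance on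 $\mathbb D^d$. A sequence $(z_n)$ in $\mathbb D^d$ is weakly separated if $\inf_{n\ne k}\rho_G(z_n,z_k)>0$, and uniformly separated if $\inf_n\prod_{k\ne n}\rho_G(z_n,z_k)>0$. Let $H^2(\mathbb D^d)$ be the Hardy space, i.e. the reproducing kernel Hilbert space on $\mathbb D^d$ with the Szegö kernel $\prod_{i=1}^d(1-z^i\overline{w^i})^{-1}$. A measure $\mu$ on $\mathbb D^d$ is a Carleson measure for $H^2(\mathbb D^d)$ if there is $C>0$ with $\|f\|_{L^2(\mathbb D^d,\mu)}\le C\|f\|_{H^2(\mathbb D^d)}$ for all $f\in H^2(\mathbb D^d)$. Let $\mu_\Lambda=\sum_{n}\left(\prod_{i=1}^d(1-|\lambda_n^i|^2)\right)\delta_{\lambda_n}$. Then: (i) If $\sum_{m\in\mathbb N^d}N_m^2\,2^{-|m|}<\infty$ and $r_n=(0,\dots,0)$ for at most one $n$, then $\Lambda$ is almost surely weakly separated. If $\sum_{m\in\mathbb N^d}N_m^2\,2^{-|m|}=\infty$, then $\Lambda$ is almost surely not weakly separated. (ii) If $\sum_{m\in\mathbb N^d}N_m^{1+1/d}\,2^{-|m|/d}<\infty$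 and $r_n=(0,\dots,0)$ for at most one $n$, then $\Lambda$ is almost surely uniformly separated. (iii) If $\sum_{m\in\mathbb N^d}N_m^2\,2^{-|m|}<\infty$, then $\mu_\Lambda$ is almost surely a Carleson measure for $H^2(\mathbb D^d)$. -/

import Mathlib

open MeasureTheory ProbabilityTheory Filter Topology
open scoped ENNReal ComplexConjugate

noncomputable section

/-- The unit polydisc `𝔻^d` in `ℂ^d`. -/
abbrev Polydisc (d : ℕ) : Type := {z : Fin d → ℂ // ∀ i, ‖z i‖ < 1}

/-- The pseudo-hyperbolic distance `|(z - w) / (1 - conj z * w)|` on the unit disc. -/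
def pseudoHyperbolicDist (z w : ℂ) : ℝ :=
  ‖(z - w) / (1 - conj z * w)‖

/-- The Gleason distance on the polydisc: the maximum over the coordinates of the
pseudo-hyperbolic distances. -/
def gleasonDist {d : ℕ} (z w : Polydisc d) : ℝ :=
  ⨆ i : Fin d, pseudoHyperbolicDist (z.1 i) (w.1 i)

/-- `inf_{n ≠ k} ρ_G(z_n, z_k) > 0`. -/
def WeaklySeparated {d : ℕ} (Z : ℕ → Polydisc d) : Prop :=
  ∃ δ : ℝ, 0 < δ ∧ ∀ n k : ℕ, n ≠ k → δ ≤ gleasonDist (Z n) (Z k)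

/-- `inf_n ∏_{k ≠ n} ρ_G(z_n, z_k) > 0`. All factors lie in `[0, 1]`, so each infinite product
converges (possibly to `0`). -/
def UniformlySeparated {d : ℕ} (Z : ℕ → Polydisc d) : Prop :=
  ∃ δ : ℝ, 0 < δ ∧ ∀ n : ℕ, δ ≤ ∏' k : {k : ℕ // k ≠ n}, gleasonDist (Z n) (Z k)

/-- The Szegö kernel `s_d(z, w) = ∏ i, 1 / (1 - z^i * conj w^i)` of the polydisc. -/
def szego (d : ℕ) (z w : Polydisc d) : ℂ :=
  ∏ i : Fin d, (1 - z.1 i * conj (w.1 i))⁻¹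

/-- The Szegö kernel as an operator-valued kernel on `ℂ`: the entry at `(z, w)` is multiplication
by `s_d(z, w)`. -/
def szegoKernel (d : ℕ) : Matrix (Polydisc d) (Polydisc d) (ℂ →L[ℂ] ℂ) :=
  Matrix.of fun z w => szego d z w • ContinuousLinearMap.id ℂ ℂ

/-- Partial sums of the expansion of the Szegö kernel into monomials. -/
lemma tendsto_szego (d : ℕ) (z w : Polydisc d) :
    Tendsto (fun N : ℕ => ∑ a ∈ Fintype.piFinset (fun _ : Fin d => Finset.range N),
      (∏ i, z.1 i ^ a i) * conj (∏ i, w.1 i ^ a i)) atTop (𝓝 (szego d z w)) := by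
  have h : Tendsto (fun N : ℕ => ∏ i : Fin d, ∑ j ∈ Finset.range N,
      (z.1 i * conj (w.1 i)) ^ j) atTop (𝓝 (szego d z w)) := by
    refine tendsto_finsetProd _ fun i _ => ?_
    refine (hasSum_geometric_of_norm_lt_one ?_).tendsto_sum_nat
    rw [norm_mul, RCLike.norm_conj]
    have h1 := z.2 i
    have h2 := w.2 i
    have h3 := norm_nonneg (z.1 i)
    have h4 := norm_nonneg (w.1 i)
    nlinarith
  refine h.congr fun N => ?_
  rw [Finset.prod_univ_sum]
  refine Finset.sum_congr rfl fun a _ => ?_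
  rw [map_prod, ← Finset.prod_mul_distrib]
  simp [mul_pow]

lemma szegoKernel_posSemidef (d : ℕ) : (szegoKernel d).PosSemidef := by
  have key := (RKHS.posSemidef_tfae (K := szegoKernel d)).out 0 1
  rw [key]
  refine ⟨?_, fun f => ?_⟩
  · ext z w
    have h1 : ContinuousLinearMap.adjoint (ContinuousLinearMap.id ℂ ℂ) =
        ContinuousLinearMap.id ℂ ℂ := ContinuousLinearMap.adjoint_id
    simp [szegoKernel, szego, ContinuousLinearMap.star_eq_adjoint, mul_comm, h1]
  · have h : Tendsto (fun N : ℕ => ∑ a ∈ Fintype.piFinset (fun _ : Fin d => Finset.range N),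
        ‖f.sum fun xv c => conj c * conj xv.2 * ∏ i, xv.1.1 i ^ a i‖ ^ 2) atTop
        (𝓝 (RCLike.re (f.sum fun xv z => f.sum fun xv' w =>
          conj z * w * inner ℂ (szegoKernel d xv'.1 xv.1 xv.2) xv'.2))) := by
      have h2 : Tendsto (fun N : ℕ => f.sum fun xv z => f.sum fun xv' w =>
          conj z * w * (xv'.2 * conj xv.2 *
            ∑ a ∈ Fintype.piFinset (fun _ : Fin d => Finset.range N),
              (∏ i, xv.1.1 i ^ a i) * conj (∏ i, xv'.1.1 i ^ a i))) atTop
          (𝓝 (f.sum fun xv z => f.sum fun xv' w =>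
            conj z * w * inner ℂ (szegoKernel d xv'.1 xv.1 xv.2) xv'.2)) := by
        refine tendsto_finsetSum _ fun xv _ => tendsto_finsetSum _ fun xv' _ => ?_
        have h3 := ((tendsto_szego d xv.1 xv'.1).const_mul (xv'.2 * conj xv.2)).const_mul
          (conj (f xv) * f xv')
        convert! h3 using 2
        simp [szegoKernel, szego, mul_comm]
        left
        ring
      refine ((RCLike.continuous_re.tendsto _).comp h2).congr fun N => ?_
      have h4 : ∀ u : ℂ, ‖u‖ ^ 2 = RCLike.re (u * conj u) := fun u => by
        rw [RCLike.mul_conj]; norm_cast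
      simp only [Function.comp_apply, h4, Finsupp.sum]
      rw [← map_sum]
      congr 1
      simp only [map_sum]
      simp only [Finset.sum_mul_sum]
      simp only [Finset.mul_sum]
      symm
      rw [Finset.sum_comm]
      refine Finset.sum_congr rfl fun xv _ => ?_
      rw [Finset.sum_comm]
      refine Finset.sum_congr rfl fun xv' _ => Finset.sum_congr rfl fun a _ => ?_
      simp only [map_mul, Complex.conj_conj]
      ring
    exact ge_of_tendsto' h fun N => Finset.sum_nonneg fun a _ => by positivity

instance szegoKernel_fact (d : ℕ) : Fact (szegoKernel d).PosSemidef :=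
  ⟨szegoKernel_posSemidef d⟩

/-- The Hardy space `H²(𝔻^d)`: the reproducing kernel Hilbert space of functions on the polydisc
with the Szegö kernel as its kernel. -/
abbrev HardySpace (d : ℕ) : Type := RKHS.OfKernel (szegoKernel d)

lemma hardySpace_kernel (d : ℕ) : RKHS.kernel (HardySpace d) = szegoKernel d :=
  RKHS.OfKernel.kernel_ofKernel

/-- A measure `μ` on `X` is a Carleson measure for a reproducing kernel Hilbert space `H` of
complex functions on `X` if `‖f‖_{L²(X, μ)} ≤ C ‖f‖_H` for all `f ∈ H`, for some `C > 0`. -/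
def IsCarlesonMeasure (H : Type*) {X : Type*} [NormedAddCommGroup H] [InnerProductSpace ℂ H]
    [RKHS ℂ H X ℂ] [MeasurableSpace X] (μ : Measure X) : Prop :=
  ∃ C : ℝ, 0 < C ∧ ∀ f : H, eLpNorm (fun x : X => f x) 2 μ ≤ ENNReal.ofReal (C * ‖f‖)

/-- The measure `μ_Z = ∑ₙ (∏ᵢ (1 - |z_nⁱ|²)) δ_{z_n}`. -/
def sequenceMeasure {d : ℕ} (Z : ℕ → Polydisc d) : Measure (Polydisc d) :=
  Measure.sum fun n => ENNReal.ofReal (∏ i, (1 - ‖(Z n).1 i‖ ^ 2)) • Measure.dirac (Z n)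

/-- The sequence of points `λ_n = (r_n^1 e^{iθ_n^1}, …, r_n^d e^{iθ_n^d})`. -/
def polarSequence {d : ℕ} (r : ℕ → Fin d → Set.Ico (0 : ℝ) 1) (θ : ℕ → Fin d → ℝ) :
    ℕ → Polydisc d :=
  fun n => ⟨fun i => (r n i : ℝ) * Complex.exp (θ n i * Complex.I), fun i => by
    rw [norm_mul, Complex.norm_exp_ofReal_mul_I, mul_one, Complex.norm_real, Real.norm_eq_abs,
      abs_of_nonneg (r n i).2.1]
    exact (r n i).2.2⟩

/-- The dyadic shell `I_m = {z : 1 - 2^{-m_i} ≤ |z^i| < 1 - 2^{-(m_i + 1)} for all i}`. -/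
def dyadicShell {d : ℕ} (m : Fin d → ℕ) : Set (Polydisc d) :=
  {z | ∀ i, 1 - (2 : ℝ)⁻¹ ^ m i ≤ ‖z.1 i‖ ∧ ‖z.1 i‖ < 1 - (2 : ℝ)⁻¹ ^ (m i + 1)}

/-- The number `N_m` (possibly `∞`) of points of a sequence with radii `r` in the shell `I_m`,
counted by their indices. It depends on the radii only. -/
def shellCount {d : ℕ} (r : ℕ → Fin d → Set.Ico (0 : ℝ) 1) (m : Fin d → ℕ) : ℕ∞ :=
  {n : ℕ | ∀ i, 1 - (2 : ℝ)⁻¹ ^ m i ≤ r n i ∧ (r n i : ℝ) < 1 - (2 : ℝ)⁻¹ ^ (m i + 1)}.encard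

/-- Whatever the arguments are, `N_m` counts the points of the sequence in the shell `I_m`. -/
lemma shellCount_eq {d : ℕ} (r : ℕ → Fin d → Set.Ico (0 : ℝ) 1) (θ : ℕ → Fin d → ℝ)
    (m : Fin d → ℕ) :
    {n : ℕ | polarSequence r θ n ∈ dyadicShell m}.encard = shellCount r m := by
  have h : ∀ n i, ‖(polarSequence r θ n).1 i‖ = r n i := fun n i => by
    simp only [polarSequence]
    rw [norm_mul, Complex.norm_exp_ofReal_mul_I, mul_one, Complex.norm_real, Real.norm_eq_abs,
      abs_of_nonneg (r n i).2.1]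
  simp [dyadicShell, shellCount, h]

/-- The sum `∑_m N_m² 2^{-|m|}` over multi-indices `m ∈ ℕ^d`, with values in `[0, ∞]`. -/
def weakSum {d : ℕ} (r : ℕ → Fin d → Set.Ico (0 : ℝ) 1) : ℝ≥0∞ :=
  ∑' m : Fin d → ℕ, (shellCount r m : ℝ≥0∞) ^ 2 * (2 : ℝ≥0∞)⁻¹ ^ (∑ i, m i)

/-- The sum `∑_m N_m^{1 + 1/d} 2^{-|m|/d}` over multi-indices `m ∈ ℕ^d`, with values
in `[0, ∞]`. -/
def strongSum {d : ℕ} (r : ℕ → Fin d → Set.Ico (0 : ℝ) 1) : ℝ≥0∞ :=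
  ∑' m : Fin d → ℕ, (shellCount r m : ℝ≥0∞) ^ (1 + 1 / (d : ℝ)) *
    (2 : ℝ≥0∞) ^ (-(((∑ i, m i : ℕ) : ℝ) / (d : ℝ)))

end

/-! Everything rests on the defect `1 - ρ²` of the pseudo-hyperbolic distance. In one variable it is
the squared modulus of the normalized Szegö kernel, so the product of the `d` coordinate defects is
the squared modulus of an entry of the normalized Gram matrix of the sequence. For polar points the
defect depends on the angles through their difference only, and expectations over a pair of points
factor into one-dimensional integrals.

Convergence for (i) and (iii). The mean defect at radii `r`, `s` is at most a constant times `min (1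
- r) (1 - s)` (`lintegral_polarDefect_le`). Over two shells `m`, `l` the product of these minima is
about `2^{-max(m_i, l_i)}` in each coordinate, that is, `2^{-(|m| + |l|)/2}` times a kernel decaying
geometrically in `m - l`. A Schur-type estimate bounds the sum over all pairs by a multiple of
`weakSum` (`tsum_tsum_prod_min_ne_top`). Hence the off-diagonal Gram entries are almost surely
square summable. Since `(1 - ρ_G²)^d` is at most the product of the defects, only finitely many
pairs are close, and almost sure distinctness of the points gives weak separation. An off-diagonal
part that is Hilbert-Schmidt also makes the Gram matrix bounded, which by duality is the Carleson
property.

Uniform separation. Given weak separation, it is enough that `1 - ρ_G²` is summable over pairs. For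
`α ≤ 1/d` this quantity is at most the product of the defects to the power `α`, and for `α < 1/2`
the mean of that power is at most `C ((1 - r)(1 - s))^α`, which decouples the two points. What
remains is the finiteness of `∑ N_m 2^{-α|m|}`. Finiteness of `strongSum` forces `N_m ≤ C
2^{|m|/(d+1)}`, so any `α > 1/(d+1)` will do. For `d ≥ 2` there is room between `1/(d+1)` and `1/d`;
for `d = 1` the two sums coincide and `α = 1` is used.

Divergence in (i). For fixed `K`, shells are cut into radial layers and the torus into boxes, so
that two points in one cell are at distance `O(1/K)`. Within a layer the boxes are independent and
uniform: a birthday problem. The probability of no collision is an exact product of factors `1 - c_n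
p_n`, at most `exp (-∑ c_n p_n)`, and the exponent diverges because pairs within layers control
`N_m²` up to terms summable against `2^{-|m|}`. -/

/-! ### Uniform angles and their differences. -/

/-- The uniform law on `[0, 2π)`. -/
noncomputable def angleLaw : Measure ℝ :=
  (ENNReal.ofReal (2 * Real.pi))⁻¹ • volume.restrict (Set.Ico 0 (2 * Real.pi))

lemma angleLaw_apply (s : Set ℝ) :
    angleLaw s = (ENNReal.ofReal (2 * Real.pi))⁻¹ *
      volume.restrict (Set.Ico 0 (2 * Real.pi)) s := rfl

lemma ofReal_two_pi_ne_zero : ENNReal.ofReal (2 * Real.pi) ≠ 0 := by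
  simpa using Real.pi_pos

instance isProbabilityMeasure_angleLaw : IsProbabilityMeasure angleLaw := ⟨by
  rw [angleLaw_apply, Measure.restrict_apply_univ, Real.volume_Ico, sub_zero]
  exact ENNReal.inv_mul_cancel ofReal_two_pi_ne_zero ENNReal.ofReal_ne_top⟩

lemma map_eq_pi_angleLaw {d : ℕ} {Ω : Type*} [MeasurableSpace Ω] {P : Measure Ω}
    {X : Ω → Fin d → ℝ}
    (h : pdf.IsUniform X (Set.univ.pi fun _ : Fin d => Set.Ico 0 (2 * Real.pi)) P volume) :
    P.map X = Measure.pi fun _ => angleLaw := by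
  symm
  refine Measure.pi_eq fun s hs => ?_
  have hm : MeasurableSet (Set.univ.pi fun _ : Fin d => Set.Ico 0 (2 * Real.pi)) :=
    MeasurableSet.univ_pi fun _ => measurableSet_Ico
  rw [h, cond_apply hm, ← Set.pi_inter_distrib, volume_pi_pi, volume_pi_pi]
  simp only [angleLaw_apply, Finset.prod_mul_distrib, Finset.prod_const, Real.volume_Ico, sub_zero,
    Finset.card_univ, Fintype.card_fin]
  rw [ENNReal.inv_pow]
  congr 1
  refine Finset.prod_congr rfl fun i _ => ?_
  rw [Measure.restrict_apply (hs i), Set.inter_comm]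

/-- Rotation invariance: a periodic function has the same integral over any period. The window is
centred at `0` because the defect peaks there and will be estimated through `|x|`. -/
lemma lintegral_angleLaw_sub {f : ℝ → ℝ≥0∞} (hf : Function.Periodic f (2 * Real.pi)) (a : ℝ) :
    ∫⁻ x, f (x - a) ∂angleLaw =
      (ENNReal.ofReal (2 * Real.pi))⁻¹ * ∫⁻ x in Set.Ioc (-Real.pi) Real.pi, f x := by
  have hπ : 0 < 2 * Real.pi := by positivity
  have : VAddInvariantMeasure (AddSubgroup.zmultiples (2 * Real.pi)) ℝ volume :=
    ⟨fun c s _ => measure_preimage_add _ _ _⟩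
  rw [angleLaw, lintegral_smul_measure, smul_eq_mul, restrict_Ico_eq_restrict_Ioc]
  congr 1
  have h1 : ∫⁻ x in Set.Ioc 0 (2 * Real.pi), f (x - a) =
      ∫⁻ x in Set.Ioc (0 - a) (0 - a + 2 * Real.pi), f x := by
    have e : MeasurePreserving (fun x : ℝ => x - a) volume volume := measurePreserving_sub_right _ a
    have he : MeasurableEmbedding (fun x : ℝ => x - a) := measurableEmbedding_subRight a
    have hpre : Set.Ioc 0 (2 * Real.pi) =
        (fun x : ℝ => x - a) ⁻¹' Set.Ioc (0 - a) (0 - a + 2 * Real.pi) := by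
      ext x
      simp only [Set.mem_Ioc, Set.mem_preimage]
      constructor <;> rintro ⟨h1, h2⟩ <;> constructor <;> linarith
    rw [hpre]
    exact e.setLIntegral_comp_preimage_emb he f _
  have h2 : Set.Ioc (-Real.pi) Real.pi = Set.Ioc (-Real.pi) (-Real.pi + 2 * Real.pi) := by
    congr 1; ring
  rw [h1, h2]
  refine IsAddFundamentalDomain.setLIntegral_eq (G := AddSubgroup.zmultiples (2 * Real.pi))
    (isAddFundamentalDomain_Ioc hπ _) (isAddFundamentalDomain_Ioc hπ _) _ ?_
  rintro ⟨g, hg⟩ x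
  obtain ⟨n, rfl⟩ := AddSubgroup.mem_zmultiples_iff.1 hg
  have := hf.zsmul n x
  simpa [add_comm, AddSubgroup.vadd_def] using this

lemma lintegral_pi_prod {d : ℕ} (μ : Measure ℝ) [IsProbabilityMeasure μ] {f : Fin d → ℝ → ℝ≥0∞}
    (hf : ∀ i, Measurable (f i)) :
    ∫⁻ x, ∏ i, f i (x i) ∂(Measure.pi fun _ : Fin d => μ) = ∏ i, ∫⁻ x, f i x ∂μ := by
  have h := lintegral_prod_eq_prod_lintegral_of_indepFun (μ := Measure.pi fun _ : Fin d => μ)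
    Finset.univ (fun i x => f i (x i))
    (iIndepFun_pi fun i => (hf i).aemeasurable) (fun i => (hf i).comp (measurable_pi_apply i))
  rw [h]
  refine Finset.prod_congr rfl fun i _ => ?_
  exact (measurePreserving_eval (fun _ : Fin d => μ) i).lintegral_comp (hf i)

/-- Periodic product functions of the difference of two independent uniform angle vectors. -/
lemma lintegral_prod_sub_of_indepFun {d : ℕ} {Ω : Type*} [MeasurableSpace Ω] {P : Measure Ω}
    [IsProbabilityMeasure P] {X Y : Ω → Fin d → ℝ} (hX : Measurable X) (hY : Measurable Y)
    (hXlaw : P.map X = Measure.pi fun _ => angleLaw)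
    (hXY : IndepFun X Y P) {f : Fin d → ℝ → ℝ≥0∞} (hf : ∀ i, Measurable (f i))
    (hper : ∀ i, Function.Periodic (f i) (2 * Real.pi)) :
    ∫⁻ ω, ∏ i, f i (X ω i - Y ω i) ∂P =
      ∏ i, ((ENNReal.ofReal (2 * Real.pi))⁻¹ * ∫⁻ x in Set.Ioc (-Real.pi) Real.pi, f i x) := by
  have hF : Measurable fun p : (Fin d → ℝ) × (Fin d → ℝ) => ∏ i, f i (p.1 i - p.2 i) := by
    refine Finset.measurable_prod _ fun i _ => (hf i).comp ?_
    fun_prop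
  have : IsProbabilityMeasure (P.map Y) := Measure.isProbabilityMeasure_map hY.aemeasurable
  have h1 := (indepFun_iff_map_prod_eq_prod_map_map hX.aemeasurable hY.aemeasurable).1 hXY
  have h2 : ∫⁻ ω, ∏ i, f i (X ω i - Y ω i) ∂P =
      ∫⁻ p, ∏ i, f i (p.1 i - p.2 i) ∂(P.map fun ω => (X ω, Y ω)) :=
    (lintegral_map hF (hX.prodMk hY)).symm
  rw [h2, h1, lintegral_prod_symm' _ hF, hXlaw]
  have h3 : ∀ y : Fin d → ℝ, ∫⁻ x, ∏ i, f i (x i - y i) ∂(Measure.pi fun _ : Fin d => angleLaw) =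
      ∏ i, ((ENNReal.ofReal (2 * Real.pi))⁻¹ *
        ∫⁻ x in Set.Ioc (-Real.pi) Real.pi, f i x) := fun y => by
    rw [lintegral_pi_prod angleLaw (f := fun i x => f i (x - y i))
      (fun i => (hf i).comp (by fun_prop))]
    exact Finset.prod_congr rfl fun i _ => lintegral_angleLaw_sub (hper i) _
  simp [h3]

/-! ### One-dimensional integrals of the defect. -/

/-- The value of `1 - ρ²` at two points of the disc with moduli `r`, `s` whose arguments differ
by `x`. -/
noncomputable def polarDefect (r s x : ℝ) : ℝ :=
  (1 - r ^ 2) * (1 - s ^ 2) / ‖1 - (r * s : ℝ) * Complex.exp (x * Complex.I)‖ ^ 2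

lemma measurable_polarDefect (r s : ℝ) : Measurable (polarDefect r s) := by
  unfold polarDefect
  fun_prop

lemma periodic_polarDefect (r s : ℝ) : Function.Periodic (polarDefect r s) (2 * Real.pi) := by
  intro x
  have : Complex.exp (((x + 2 * Real.pi : ℝ) : ℂ) * Complex.I) = Complex.exp (x * Complex.I) := by
    push_cast
    rw [add_mul, Complex.exp_periodic]
  simp only [polarDefect, this]

lemma one_sub_le_norm_one_sub_mul_exp {t : ℝ} (ht : 0 ≤ t) (x : ℝ) :
    1 - t ≤ ‖1 - (t : ℂ) * Complex.exp (x * Complex.I)‖ := by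
  have h := norm_sub_norm_le (1 : ℂ) ((t : ℂ) * Complex.exp (x * Complex.I))
  rw [norm_mul, Complex.norm_exp_ofReal_mul_I, norm_one, Complex.norm_real, Real.norm_eq_abs,
    abs_of_nonneg ht, mul_one] at h
  exact h

/-- The chord `|e^{ix} - 1| = 2 |sin (x/2)|` is at least `2|x|/π`. Replacing `e^{ix}` by `t e^{ix}`
costs `1 - t`, which is itself at most the norm on the right; hence the loss of a factor `2`. -/
lemma abs_div_pi_le_norm_one_sub_mul_exp {t x : ℝ} (ht : 0 ≤ t) (ht1 : t ≤ 1)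
    (hx : |x| ≤ Real.pi) : |x| / Real.pi ≤ ‖1 - (t : ℂ) * Complex.exp (x * Complex.I)‖ := by
  have h1 := one_sub_le_norm_one_sub_mul_exp ht x
  have h2 : ‖Complex.exp (Complex.I * x) - 1‖ ≤
      ‖1 - (t : ℂ) * Complex.exp (x * Complex.I)‖ + (1 - t) := by
    have e : Complex.exp (Complex.I * x) - 1 =
        -(1 - (t : ℂ) * Complex.exp (x * Complex.I)) + ((1 - t : ℝ) : ℂ) *
          Complex.exp (x * Complex.I) := by
      rw [mul_comm Complex.I]; push_cast; ring
    rw [e]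
    refine (norm_add_le _ _).trans ?_
    rw [norm_neg, norm_mul, Complex.norm_exp_ofReal_mul_I, mul_one, Complex.norm_real,
      Real.norm_eq_abs, abs_of_nonneg (by linarith : 0 ≤ 1 - t)]
  rw [Complex.norm_exp_I_mul_ofReal_sub_one] at h2
  have h3 : 2 / Real.pi * |x / 2| ≤ |Real.sin (x / 2)| := by
    apply Real.mul_abs_le_abs_sin
    rw [abs_div, abs_two]; linarith
  rw [Real.norm_eq_abs, abs_mul, abs_two] at h2
  rw [abs_div, abs_two] at h3
  have h4 : 2 / Real.pi * (|x| / 2) = |x| / Real.pi := by ring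
  linarith

/-- The defect is a Poisson-type kernel. The two lower bounds `1 - t` and `|x|/π` for its
denominator dominate it by a Cauchy density, which is integrated over the whole line. -/
lemma lintegral_polarDefect_le {r s : ℝ} (hr : r ∈ Set.Ico (0 : ℝ) 1) (hs : s ∈ Set.Ico (0 : ℝ) 1) :
    ∫⁻ x in Set.Ioc (-Real.pi) Real.pi, ENNReal.ofReal (polarDefect r s x) ≤
      ENNReal.ofReal (8 * Real.pi ^ 2 * min (1 - r) (1 - s)) := by
  obtain ⟨hr0, hr1⟩ := hr
  obtain ⟨hs0, hs1⟩ := hs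
  have hπ := Real.pi_pos
  set t := r * s with ht
  have ht0 : 0 ≤ t := mul_nonneg hr0 hs0
  have htr : t ≤ r := mul_le_of_le_one_right hr0 hs1.le
  have hts : t ≤ s := mul_le_of_le_one_left hs0 hr1.le
  -- This scale makes `(1 - t)² (b x)² = (x/π)²`.
  set b := (Real.pi * (1 - t))⁻¹ with hb
  have ht1 : 0 < 1 - t := by linarith
  have hb0 : 0 < b := by positivity
  set A := (1 - r ^ 2) * (1 - s ^ 2) with hA
  have hA0 : 0 ≤ A := mul_nonneg (by nlinarith) (by nlinarith)
  have hint : Integrable fun x : ℝ => 2 * A / (1 - t) ^ 2 * (1 + (b * x) ^ 2)⁻¹ :=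
    (integrable_inv_one_add_sq.comp_mul_left' hb0.ne').const_mul _
  have hpt : ∀ x ∈ Set.Ioc (-Real.pi) Real.pi,
      polarDefect r s x ≤ 2 * A / (1 - t) ^ 2 * (1 + (b * x) ^ 2)⁻¹ := by
    intro x hx
    have h1 := one_sub_le_norm_one_sub_mul_exp ht0 x
    have h2 := abs_div_pi_le_norm_one_sub_mul_exp ht0 (by linarith) (abs_le.2 ⟨hx.1.le, hx.2⟩)
    have h3 : (1 - t) ^ 2 * (1 + (b * x) ^ 2) ≤
        2 * ‖1 - (t : ℂ) * Complex.exp (x * Complex.I)‖ ^ 2 := by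
      have e : (1 - t) ^ 2 * (1 + (b * x) ^ 2) = (1 - t) ^ 2 + (|x| / Real.pi) ^ 2 := by
        rw [hb, div_pow, sq_abs]; field_simp
      rw [e]
      have h5 : 0 ≤ |x| / Real.pi := by positivity
      have := pow_le_pow_left₀ h5 h2 2
      have := pow_le_pow_left₀ ht1.le h1 2
      linarith
    have hn : 0 < ‖1 - (t : ℂ) * Complex.exp (x * Complex.I)‖ := by linarith
    unfold polarDefect
    rw [← ht, ← hA, div_mul_eq_mul_div, mul_comm (2 * A), ← div_eq_inv_mul, div_div,
      div_le_div_iff₀ (by positivity) (by positivity)]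
    nlinarith
  calc _ ≤ ∫⁻ x in Set.Ioc (-Real.pi) Real.pi,
        ENNReal.ofReal (2 * A / (1 - t) ^ 2 * (1 + (b * x) ^ 2)⁻¹) :=
        setLIntegral_mono' measurableSet_Ioc fun x hx => ENNReal.ofReal_le_ofReal (hpt x hx)
    _ ≤ ∫⁻ x, ENNReal.ofReal (2 * A / (1 - t) ^ 2 * (1 + (b * x) ^ 2)⁻¹) :=
        setLIntegral_le_lintegral _ _
    _ = ENNReal.ofReal (2 * A / (1 - t) ^ 2 * (b⁻¹ * Real.pi)) := by
        rw [← ofReal_integral_eq_lintegral_ofReal hint (ae_of_all _ fun x => by positivity),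
          integral_const_mul, Measure.integral_comp_mul_left (fun x => (1 + x ^ 2)⁻¹) b,
          integral_univ_inv_one_add_sq, smul_eq_mul, abs_of_pos (by positivity)]
    _ ≤ _ := by
        refine ENNReal.ofReal_le_ofReal ?_
        have e : 2 * A / (1 - t) ^ 2 * (b⁻¹ * Real.pi) = 2 * Real.pi ^ 2 * (A / (1 - t)) := by
          rw [hb, inv_inv]; field_simp
        have hA4 : A ≤ 4 * ((1 - r) * (1 - s)) := by
          have h1 : 1 - r ^ 2 ≤ 2 * (1 - r) := by nlinarith
          have h2 : 1 - s ^ 2 ≤ 2 * (1 - s) := by nlinarith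
          have := mul_le_mul h1 h2 (by nlinarith) (by linarith)
          linarith
        -- Since `t ≤ r` and `t ≤ s`, the denominator cancels the larger of the two factors `1 - r`,
        -- `1 - s`.
        have key : A / (1 - t) ≤ 4 * min (1 - r) (1 - s) := by
          rw [div_le_iff₀ ht1]
          rcases le_total (1 - r) (1 - s) with h | h
          · rw [min_eq_left h]; nlinarith
          · rw [min_eq_right h]; nlinarith
        rw [e]
        have := mul_le_mul_of_nonneg_left key (by positivity : 0 ≤ 2 * Real.pi ^ 2)
        linarith

/-- Using `|x|/π` alone, the defect is at most `C (1 - r)(1 - s)/x²`, and `|x|^{-2α}` is integrable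
at `0` because `2α < 1`. Unlike the bound by the minimum, this one is a product of a function of `r`
and a function of `s`. -/
lemma lintegral_polarDefect_rpow_le {α : ℝ} (hα : 0 < α) (hα2 : α < 1 / 2) :
    ∃ C : ℝ≥0∞, C ≠ ∞ ∧ ∀ r ∈ Set.Ico (0 : ℝ) 1, ∀ s ∈ Set.Ico (0 : ℝ) 1,
      ∫⁻ x in Set.Ioc (-Real.pi) Real.pi, ENNReal.ofReal (polarDefect r s x) ^ α ≤
        C * (ENNReal.ofReal (1 - r) ^ α * ENNReal.ofReal (1 - s) ^ α) := by
  have hπ := Real.pi_pos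
  have hI : IntegrableOn (fun x : ℝ => |x| ^ (-(2 * α))) (Set.Ioc (-Real.pi) Real.pi) := by
    have h1 : IntervalIntegrable (fun x : ℝ => |x| ^ (-(2 * α))) volume 0 Real.pi := by
      refine (intervalIntegral.intervalIntegrable_rpow' (r := -(2 * α)) (by linarith)).congr ?_
      intro x hx
      rw [Set.uIoc_of_le hπ.le] at hx
      simp [abs_of_pos hx.1]
    have h2 : IntervalIntegrable (fun x : ℝ => |x| ^ (-(2 * α))) volume (-Real.pi) 0 := by
      have := ((IntervalIntegrable.iff_comp_neg enorm_ne_top).1 h1).symm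
      simpa using this
    exact (intervalIntegrable_iff_integrableOn_Ioc_of_le (by linarith)).1 (h2.trans h1)
  have hfin := hI.2
  refine ⟨ENNReal.ofReal (4 * Real.pi ^ 2) ^ α * ∫⁻ x in Set.Ioc (-Real.pi) Real.pi,
    ENNReal.ofReal (|x| ^ (-(2 * α))), ENNReal.mul_ne_top
    (ENNReal.rpow_ne_top_of_nonneg hα.le ENNReal.ofReal_ne_top) ?_, ?_⟩
  · refine ne_of_lt ((lintegral_mono fun x => ?_).trans_lt hfin)
    rw [Real.enorm_eq_ofReal (by positivity)]
  rintro r ⟨hr0, hr1⟩ s ⟨hs0, hs1⟩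
  rw [mul_right_comm, ← lintegral_const_mul _ (by fun_prop)]
  refine lintegral_mono_ae ?_
  rw [ae_restrict_iff' measurableSet_Ioc]
  have h0 : ∀ᵐ x : ℝ, x ≠ 0 := by simp [ae_iff]
  filter_upwards [h0] with x hx0 hx
  have ht0 : 0 ≤ r * s := mul_nonneg hr0 hs0
  have h2 := abs_div_pi_le_norm_one_sub_mul_exp ht0 (by nlinarith) (abs_le.2 ⟨hx.1.le, hx.2⟩)
  have hxp : 0 < |x| := abs_pos.2 hx0
  have hA4 : (1 - r ^ 2) * (1 - s ^ 2) ≤ 4 * ((1 - r) * (1 - s)) := by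
    have h1 : 1 - r ^ 2 ≤ 2 * (1 - r) := by nlinarith
    have h2 : 1 - s ^ 2 ≤ 2 * (1 - s) := by nlinarith
    have := mul_le_mul h1 h2 (by nlinarith) (by linarith)
    linarith
  have hle : polarDefect r s x ≤ 4 * Real.pi ^ 2 * |x| ^ (-(2 : ℝ)) * ((1 - r) * (1 - s)) := by
    unfold polarDefect
    rw [Real.rpow_neg hxp.le]
    norm_cast
    have h3 : (|x| / Real.pi) ^ 2 ≤ ‖1 - ((r * s : ℝ) : ℂ) * Complex.exp (x * Complex.I)‖ ^ 2 :=
      pow_le_pow_left₀ (by positivity) h2 2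
    refine (div_le_div_of_nonneg_left (mul_nonneg (by nlinarith) (by nlinarith)) (by positivity)
      h3).trans ?_
    rw [div_pow, div_div_eq_mul_div, div_eq_mul_inv]
    have : 0 ≤ Real.pi ^ 2 * (|x| ^ 2)⁻¹ := by positivity
    nlinarith
  calc ENNReal.ofReal (polarDefect r s x) ^ α
      ≤ ENNReal.ofReal (4 * Real.pi ^ 2 * |x| ^ (-(2 : ℝ)) * ((1 - r) * (1 - s))) ^ α :=
        ENNReal.rpow_le_rpow (ENNReal.ofReal_le_ofReal hle) hα.le
    _ = _ := by
        have h1r : 0 ≤ 1 - r := by linarith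
        have h1s : 0 ≤ 1 - s := by linarith
        rw [ENNReal.ofReal_mul (by positivity), ENNReal.ofReal_mul (by positivity),
          ENNReal.ofReal_mul h1r, ENNReal.mul_rpow_of_nonneg _ _ hα.le,
          ENNReal.mul_rpow_of_nonneg _ _ hα.le, ENNReal.mul_rpow_of_nonneg _ _ hα.le,
          ENNReal.ofReal_rpow_of_nonneg (x := |x| ^ (-(2 : ℝ))) (by positivity) hα.le,
          ← Real.rpow_mul hxp.le, neg_mul]
        ring

/-! ### Dyadic shells and the counting sums. -/

lemma exists_shellIndex (x : Set.Ico (0 : ℝ) 1) :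
    ∃ m : ℕ, (2 : ℝ)⁻¹ ^ (m + 1) < 1 - x ∧ 1 - (x : ℝ) ≤ (2 : ℝ)⁻¹ ^ m :=
  exists_nat_pow_near_of_lt_one (by linarith [x.2.2]) (by linarith [x.2.1]) (by norm_num)
    (by norm_num)

/-- The index `m` of the dyadic interval `[1 - 2^{-m}, 1 - 2^{-(m+1)})` that contains `x`. -/
noncomputable def shellIndex (x : Set.Ico (0 : ℝ) 1) : ℕ := (exists_shellIndex x).choose

lemma lt_one_sub_of_shellIndex (x : Set.Ico (0 : ℝ) 1) :
    (2 : ℝ)⁻¹ ^ (shellIndex x + 1) < 1 - x := (exists_shellIndex x).choose_spec.1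

lemma one_sub_le_of_shellIndex (x : Set.Ico (0 : ℝ) 1) :
    1 - (x : ℝ) ≤ (2 : ℝ)⁻¹ ^ shellIndex x := (exists_shellIndex x).choose_spec.2

lemma shellIndex_eq_iff (x : Set.Ico (0 : ℝ) 1) (m : ℕ) :
    shellIndex x = m ↔ 1 - (2 : ℝ)⁻¹ ^ m ≤ x ∧ (x : ℝ) < 1 - (2 : ℝ)⁻¹ ^ (m + 1) := by
  have h1 := lt_one_sub_of_shellIndex x
  have h2 := one_sub_le_of_shellIndex x
  constructor
  · rintro rfl
    constructor <;> linarith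
  · rintro ⟨h3, h4⟩
    have ha : (2 : ℝ)⁻¹ ^ (shellIndex x + 1) < (2 : ℝ)⁻¹ ^ m := by linarith
    have hb : (2 : ℝ)⁻¹ ^ (m + 1) < (2 : ℝ)⁻¹ ^ shellIndex x := by linarith
    rw [pow_lt_pow_iff_right_of_lt_one₀ (by norm_num) (by norm_num)] at ha hb
    omega

/-- The multi-index of the dyadic shell that contains the points with radii `r n`. -/
noncomputable def shellMultiIndex {d : ℕ} (r : ℕ → Fin d → Set.Ico (0 : ℝ) 1) (n : ℕ) : Fin d → ℕ :=
  fun i => shellIndex (r n i)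

lemma shellCount_eq_encard_preimage {d : ℕ} (r : ℕ → Fin d → Set.Ico (0 : ℝ) 1) (m : Fin d → ℕ) :
    shellCount r m = (shellMultiIndex r ⁻¹' {m}).encard := by
  unfold shellCount
  congr 1
  ext n
  simp only [Set.mem_ofPred_eq, Set.mem_preimage, Set.mem_singleton_iff, shellMultiIndex,
    funext_iff, shellIndex_eq_iff]

lemma tsum_comp_shellMultiIndex {d : ℕ} (r : ℕ → Fin d → Set.Ico (0 : ℝ) 1)
    (g : (Fin d → ℕ) → ℝ≥0∞) :
    ∑' n, g (shellMultiIndex r n) = ∑' m, (shellCount r m : ℝ≥0∞) * g m := by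
  rw [← ENNReal.tsum_fiberwise _ (shellMultiIndex r)]
  refine tsum_congr fun m => ?_
  rw [shellCount_eq_encard_preimage, ← ENNReal.tsum_set_const]
  refine tsum_congr fun b => ?_
  rw [b.2]

lemma tsum_pi_prod_le {d : ℕ} (f : Fin d → ℕ → ℝ≥0∞) :
    ∑' a : Fin d → ℕ, ∏ i, f i (a i) ≤ ∏ i, ∑' j, f i j := by
  rw [ENNReal.tsum_eq_iSup_sum]
  refine iSup_le fun s => ?_
  have hs : s ⊆ Fintype.piFinset fun i => s.image fun a => a i := fun a ha =>
    Fintype.mem_piFinset.2 fun i => Finset.mem_image_of_mem _ ha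
  refine (Finset.sum_le_sum_of_subset hs).trans ?_
  rw [← Finset.prod_univ_sum]
  exact Finset.prod_le_prod' fun i _ => ENNReal.sum_le_tsum _

lemma tsum_pow_sum_ne_top {d : ℕ} {c : ℝ≥0∞} (hc : c < 1) :
    ∑' m : Fin d → ℕ, c ^ (∑ i, m i) ≠ ∞ := by
  refine ne_top_of_le_ne_top ?_ ((tsum_congr fun m => ?_).trans_le
    (tsum_pi_prod_le fun (_ : Fin d) j => c ^ j))
  · refine ENNReal.prod_ne_top fun i _ => ?_
    rw [ENNReal.tsum_geometric]
    exact ENNReal.inv_ne_top.2 (tsub_pos_of_lt hc).ne'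
  · rw [Finset.prod_pow_eq_pow_sum]

lemma tsum_pow_natAbs_ne_top {q : ℝ≥0∞} (hq : q < 1) : ∑' j : ℤ, q ^ j.natAbs ≠ ∞ := by
  have h3 : (1 - q)⁻¹ ≠ ∞ := ENNReal.inv_ne_top.2 (tsub_pos_of_lt hq).ne'
  have h1 : ∑' n : ℕ, q ^ n = (1 - q)⁻¹ := ENNReal.tsum_geometric q
  have h2 : ∑' n : ℕ, q ^ (n + 1) = q * (1 - q)⁻¹ := ENNReal.tsum_geometric_add_one q
  have e : ∑' j : ℤ, q ^ j.natAbs = ∑' n : ℕ, q ^ n + ∑' n : ℕ, q ^ (n + 1) := by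
    rw [← Equiv.intEquivNatSumNat.symm.tsum_eq]
    rw [ENNReal.summable.tsum_sum ENNReal.summable]
    rfl
  rw [e, h1, h2]
  exact ENNReal.add_ne_top.2 ⟨h3, ENNReal.mul_ne_top (hq.trans ENNReal.one_lt_top).ne h3⟩

lemma tsum_prod_pow_dist_le {d : ℕ} (q : ℝ≥0∞) (m : Fin d → ℕ) :
    ∑' l : Fin d → ℕ, ∏ i, q ^ ((m i : ℤ) - l i).natAbs ≤ (∑' j : ℤ, q ^ j.natAbs) ^ d := by
  refine (tsum_pi_prod_le fun i j => q ^ ((m i : ℤ) - j).natAbs).trans ?_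
  refine (Finset.prod_le_pow_card Finset.univ _ (∑' j : ℤ, q ^ j.natAbs) fun i _ => ?_).trans_eq
    (by simp)
  refine ENNReal.tsum_comp_le_tsum_of_injective (f := fun j : ℕ => (m i : ℤ) - j) ?_
    (fun j : ℤ => q ^ j.natAbs)
  intro a b h
  simpa using h

lemma ENNReal.mul_le_sq_add_sq (a b : ℝ≥0∞) : a * b ≤ a ^ 2 + b ^ 2 := by
  rcases le_total a b with h | h
  · exact (mul_le_mul_left h b).trans ((sq b).symm.le.trans le_add_self)
  · exact (mul_le_mul_right h a).trans ((sq a).symm.le.trans le_self_add)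

/-- A Schur-type estimate: after symmetrization, the interaction between shells is a kernel with
uniformly bounded row sums, acting on the sequence `N_m 2^{-|m|/2}`, which is square summable by
hypothesis. -/
lemma tsum_tsum_prod_min_ne_top {d : ℕ} {r : ℕ → Fin d → Set.Ico (0 : ℝ) 1}
    (h : weakSum r ≠ ∞) :
    ∑' n, ∑' k, ∏ i, ENNReal.ofReal (min (1 - (r n i : ℝ)) (1 - r k i)) ≠ ∞ := by
  set q : ℝ≥0∞ := (2 : ℝ≥0∞)⁻¹ ^ (1 / 2 : ℝ) with hqdef
  have hq2 : q ^ 2 = 2⁻¹ := by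
    rw [hqdef, ← ENNReal.rpow_natCast, ← ENNReal.rpow_mul]; norm_num
  have hq1 : q < 1 := ENNReal.rpow_lt_one (by simp) (by norm_num)
  set D := (∑' j : ℤ, q ^ j.natAbs) ^ d with hD
  have hDtop : D ≠ ∞ := ENNReal.pow_ne_top (tsum_pow_natAbs_ne_top hq1)
  -- From `2 max(a, b) = a + b + |a - b|` and `q² = 1/2`: in each coordinate `2^{-max(a, b)} = q^{a
  -- + b + |a - b|}`.
  set w : (Fin d → ℕ) → (Fin d → ℕ) → ℝ≥0∞ := fun m l =>
    q ^ (∑ i, m i) * q ^ (∑ i, l i) * ∏ i, q ^ ((m i : ℤ) - l i).natAbs with hw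
  have hle1 : ∀ x : Set.Ico (0 : ℝ) 1, ENNReal.ofReal (1 - x) ≤ q ^ (2 * shellIndex x) := by
    intro x
    rw [pow_mul, hq2]
    refine (ENNReal.ofReal_le_ofReal (one_sub_le_of_shellIndex x)).trans_eq ?_
    rw [ENNReal.ofReal_pow (by norm_num), ENNReal.ofReal_inv_of_pos (by norm_num)]
    simp
  have hle : ∀ n k, ∏ i, ENNReal.ofReal (min (1 - (r n i : ℝ)) (1 - r k i)) ≤
      w (shellMultiIndex r n) (shellMultiIndex r k) := by
    intro n k
    simp only [hw, ← Finset.prod_pow_eq_pow_sum, ← Finset.prod_mul_distrib]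
    refine Finset.prod_le_prod' fun i _ => ?_
    rw [← pow_add, ← pow_add]
    simp only [shellMultiIndex]
    rcases le_total (shellIndex (r n i)) (shellIndex (r k i)) with hl | hl
    · refine (ENNReal.ofReal_le_ofReal (min_le_right _ _)).trans ((hle1 _).trans_eq ?_)
      congr 1; omega
    · refine (ENNReal.ofReal_le_ofReal (min_le_left _ _)).trans ((hle1 _).trans_eq ?_)
      congr 1; omega
  set N : (Fin d → ℕ) → ℝ≥0∞ := fun m => (shellCount r m : ℝ≥0∞) with hN
  have hws : ∀ m l, N m * (N l * w m l) ≤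
      N m ^ 2 * 2⁻¹ ^ (∑ i, m i) * ∏ i, q ^ ((m i : ℤ) - l i).natAbs +
      N l ^ 2 * 2⁻¹ ^ (∑ i, l i) * ∏ i, q ^ ((l i : ℤ) - m i).natAbs := by
    intro m l
    have e1 : ∏ i, q ^ ((l i : ℤ) - m i).natAbs = ∏ i, q ^ ((m i : ℤ) - l i).natAbs :=
      Finset.prod_congr rfl fun i _ => by rw [← Int.natAbs_neg, neg_sub]
    rw [e1, ← add_mul, ← hq2, ← pow_mul, ← pow_mul, mul_comm 2, mul_comm 2, pow_mul, pow_mul,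
      ← mul_pow, ← mul_pow]
    refine le_trans (le_of_eq ?_) (mul_le_mul_left (ENNReal.mul_le_sq_add_sq _ _) _)
    simp only [hw]
    ring
  have hA : ∑' m : Fin d → ℕ, ∑' l : Fin d → ℕ,
      N m ^ 2 * 2⁻¹ ^ (∑ i, m i) * ∏ i, q ^ ((m i : ℤ) - l i).natAbs ≤
      weakSum r * D := by
    rw [weakSum, ← ENNReal.tsum_mul_right]
    refine ENNReal.tsum_le_tsum fun m => ?_
    rw [ENNReal.tsum_mul_left]
    exact mul_le_mul_right (tsum_prod_pow_dist_le q m) _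
  have hfin : weakSum r * D ≠ ∞ := ENNReal.mul_ne_top h hDtop
  refine ne_top_of_le_ne_top (ENNReal.add_ne_top.2 ⟨hfin, hfin⟩) ?_
  calc _ ≤ ∑' n, ∑' k, w (shellMultiIndex r n) (shellMultiIndex r k) :=
        ENNReal.tsum_le_tsum fun n => ENNReal.tsum_le_tsum fun k => hle n k
    _ = ∑' m, ∑' l, N m * (N l * w m l) := by
        have e : ∀ m, ∑' k, w m (shellMultiIndex r k) = ∑' l, N l * w m l := fun m =>
          tsum_comp_shellMultiIndex r (w m)
        simp only [e, ENNReal.tsum_mul_left]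
        exact tsum_comp_shellMultiIndex r fun m => ∑' l, N l * w m l
    _ ≤ _ := by
        refine (ENNReal.tsum_le_tsum fun m => ENNReal.tsum_le_tsum fun l => hws m l).trans ?_
        simp only [ENNReal.tsum_add]
        refine add_le_add hA ?_
        rw [ENNReal.tsum_comm]
        exact hA

lemma strongSum_eq_weakSum (r : ℕ → Fin 1 → Set.Ico (0 : ℝ) 1) : strongSum r = weakSum r := by
  unfold strongSum weakSum
  refine tsum_congr fun m => ?_
  have h : (1 : ℝ) + 1 / ((1 : ℕ) : ℝ) = (2 : ℕ) := by norm_num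
  rw [h, ENNReal.rpow_natCast]
  simp only [Nat.cast_one, div_one]
  rw [ENNReal.rpow_neg, ENNReal.rpow_natCast, ENNReal.inv_pow]

/-- Only the boundedness of the terms of `strongSum` is needed: it gives `N_m ≤ C 2^{|m|/(d+1)}`,
and the excess of `α` over `1/(d+1)` leaves the geometric ratio `c < 1`. -/
lemma tsum_prod_rpow_ne_top {d : ℕ} (hd : 1 ≤ d) {r : ℕ → Fin d → Set.Ico (0 : ℝ) 1}
    (h : strongSum r ≠ ∞) {α : ℝ} (hα : 1 / ((d : ℝ) + 1) < α) :
    ∑' n, ∏ i, ENNReal.ofReal (1 - (r n i : ℝ)) ^ α ≠ ∞ := by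
  have hd0 : (0 : ℝ) < d := by exact_mod_cast hd
  have hα0 : 0 < α := lt_trans (by positivity) hα
  set b : ℝ≥0∞ := 2⁻¹ ^ α with hb
  set c : ℝ≥0∞ := 2 ^ (1 / ((d : ℝ) + 1) - α) with hc
  have hc1 : c < 1 := ENNReal.rpow_lt_one_of_one_lt_of_neg (by norm_num) (by linarith)
  -- The inverse of the exponent `1 + 1/d`; it turns `2^{-|m|/d}` into `2^{-|m|/(d+1)}`.
  set β : ℝ := d / (d + 1) with hβ
  have hβ0 : 0 < β := by positivity
  have hle : ∀ n, ∏ i, ENNReal.ofReal (1 - (r n i : ℝ)) ^ α ≤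
      b ^ (∑ i, shellMultiIndex r n i) := by
    intro n
    rw [← Finset.prod_pow_eq_pow_sum]
    refine Finset.prod_le_prod' fun i _ => ?_
    rw [hb, ← ENNReal.rpow_natCast, ← ENNReal.rpow_mul, mul_comm, ENNReal.rpow_mul,
      ENNReal.rpow_natCast]
    refine ENNReal.rpow_le_rpow ?_ hα0.le
    refine (ENNReal.ofReal_le_ofReal (one_sub_le_of_shellIndex (r n i))).trans_eq ?_
    rw [ENNReal.ofReal_pow (by norm_num), ENNReal.ofReal_inv_of_pos (by norm_num)]
    simp [shellMultiIndex]
  have hterm : ∀ m : Fin d → ℕ, (shellCount r m : ℝ≥0∞) * b ^ (∑ i, m i) ≤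
      strongSum r ^ β * c ^ (∑ i, m i) := by
    intro m
    set N : ℝ≥0∞ := (shellCount r m : ℝ≥0∞)
    set M : ℕ := ∑ i, m i
    have h1 : N ^ (1 + 1 / (d : ℝ)) * 2 ^ (-((M : ℝ) / d)) ≤ strongSum r :=
      ENNReal.le_tsum (f := fun m : Fin d → ℕ => (shellCount r m : ℝ≥0∞) ^ (1 + 1 / (d : ℝ)) *
        (2 : ℝ≥0∞) ^ (-(((∑ i, m i : ℕ) : ℝ) / (d : ℝ)))) m
    have h2 := ENNReal.rpow_le_rpow h1 hβ0.le
    have e1 : (1 + 1 / (d : ℝ)) * β = 1 := by rw [hβ]; field_simp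
    have e2 : -((M : ℝ) / d) * β = -(M / (d + 1)) := by rw [hβ]; field_simp
    rw [ENNReal.mul_rpow_of_nonneg _ _ hβ0.le, ← ENNReal.rpow_mul, ← ENNReal.rpow_mul, e1, e2,
      ENNReal.rpow_one] at h2
    have e3 : b ^ M = 2 ^ (-((M : ℝ) / (d + 1))) * c ^ M := by
      rw [hb, hc, ← ENNReal.rpow_natCast, ← ENNReal.rpow_natCast, ← ENNReal.rpow_mul,
        ← ENNReal.rpow_mul, ← ENNReal.rpow_add _ _ (by norm_num) (by norm_num), ENNReal.inv_rpow,
        ← ENNReal.rpow_neg]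
      congr 1
      field_simp
      ring
    rw [e3, ← mul_assoc]
    exact mul_le_mul_left h2 _
  refine ne_top_of_le_ne_top (ENNReal.mul_ne_top (ENNReal.rpow_ne_top_of_nonneg hβ0.le h)
    (tsum_pow_sum_ne_top (d := d) hc1)) ?_
  refine (ENNReal.tsum_le_tsum hle).trans ?_
  rw [tsum_comp_shellMultiIndex r fun m => b ^ (∑ i, m i), ← ENNReal.tsum_mul_left]
  exact ENNReal.tsum_le_tsum hterm

/-! ### Pseudo-hyperbolic and Gleason distances. -/

lemma one_sub_conj_mul_ne_zero {z w : ℂ} (hz : ‖z‖ < 1) (hw : ‖w‖ < 1) : 1 - conj z * w ≠ 0 := by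
  intro h
  have h1 : ‖conj z * w‖ = 1 := by rw [← sub_eq_zero.1 h, norm_one]
  rw [norm_mul, RCLike.norm_conj] at h1
  nlinarith [norm_nonneg z, norm_nonneg w]

lemma one_sub_pseudoHyperbolicDist_sq {z w : ℂ} (hz : ‖z‖ < 1) (hw : ‖w‖ < 1) :
    1 - pseudoHyperbolicDist z w ^ 2 =
      (1 - ‖z‖ ^ 2) * (1 - ‖w‖ ^ 2) / ‖1 - conj z * w‖ ^ 2 := by
  have h0 : ‖1 - conj z * w‖ ^ 2 ≠ 0 := by simpa using one_sub_conj_mul_ne_zero hz hw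
  rw [pseudoHyperbolicDist, norm_div, div_pow, eq_div_iff h0, sub_mul, div_mul_cancel₀ _ h0]
  simp only [← Complex.normSq_eq_norm_sq, Complex.normSq_apply, Complex.sub_re, Complex.sub_im,
    Complex.mul_re, Complex.mul_im, Complex.conj_re, Complex.conj_im, Complex.one_re,
    Complex.one_im]
  ring

lemma pseudoHyperbolicDist_nonneg (z w : ℂ) : 0 ≤ pseudoHyperbolicDist z w := norm_nonneg _

lemma pseudoHyperbolicDist_le_one {z w : ℂ} (hz : ‖z‖ < 1) (hw : ‖w‖ < 1) :
    pseudoHyperbolicDist z w ≤ 1 := by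
  have h := one_sub_pseudoHyperbolicDist_sq hz hw
  have h1 : 0 ≤ 1 - ‖z‖ ^ 2 := by nlinarith [norm_nonneg z]
  have h2 : 0 ≤ 1 - ‖w‖ ^ 2 := by nlinarith [norm_nonneg w]
  have h3 : 0 ≤ 1 - pseudoHyperbolicDist z w ^ 2 := by rw [h]; positivity
  nlinarith [pseudoHyperbolicDist_nonneg z w]

lemma pseudoHyperbolicDist_pos {z w : ℂ} (hz : ‖z‖ < 1) (hw : ‖w‖ < 1) (h : z ≠ w) :
    0 < pseudoHyperbolicDist z w :=
  norm_pos_iff.2 (div_ne_zero (sub_ne_zero.2 h) (one_sub_conj_mul_ne_zero hz hw))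

section Gleason

variable {d : ℕ} (z w : Polydisc d)

lemma pseudoHyperbolicDist_le_gleasonDist (i : Fin d) :
    pseudoHyperbolicDist (z.1 i) (w.1 i) ≤ gleasonDist z w :=
  le_ciSup (f := fun i => pseudoHyperbolicDist (z.1 i) (w.1 i)) (Set.finite_range _).bddAbove i

lemma gleasonDist_nonneg : 0 ≤ gleasonDist z w :=
  Real.iSup_nonneg fun _ => pseudoHyperbolicDist_nonneg _ _

lemma gleasonDist_le_one : gleasonDist z w ≤ 1 :=
  Real.iSup_le (fun i => pseudoHyperbolicDist_le_one (z.2 i) (w.2 i)) zero_le_one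

variable {z w} in
lemma gleasonDist_pos (h : z ≠ w) : 0 < gleasonDist z w := by
  obtain ⟨i, hi⟩ : ∃ i, z.1 i ≠ w.1 i := by
    by_contra! hc
    exact h (Subtype.ext (funext hc))
  exact (pseudoHyperbolicDist_pos (z.2 i) (w.2 i) hi).trans_le
    (pseudoHyperbolicDist_le_gleasonDist z w i)

/-- The factor `1 - ρ(z^i, w^i)²`, which is the squared modulus of the normalized Szegö kernel in
the `i`-th variable. -/
noncomputable def coordDefect (i : Fin d) : ℝ≥0∞ :=
  ENNReal.ofReal (1 - pseudoHyperbolicDist (z.1 i) (w.1 i) ^ 2)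

lemma ofReal_one_sub_gleasonDist_sq_le_coordDefect (i : Fin d) :
    ENNReal.ofReal (1 - gleasonDist z w ^ 2) ≤ coordDefect z w i := by
  refine ENNReal.ofReal_le_ofReal ?_
  have := pow_le_pow_left₀ (pseudoHyperbolicDist_nonneg _ _)
    (pseudoHyperbolicDist_le_gleasonDist z w i) 2
  linarith

/-- The Gleason defect is the smallest coordinate defect and lies in `[0, 1]`, so lowering its
exponent from `1` to `dα` increases it; the exponent is then shared equally among the coordinates.
-/
lemma ofReal_one_sub_gleasonDist_sq_le {α : ℝ} (hα : 0 ≤ α) (hdα : d * α ≤ 1) :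
    ENNReal.ofReal (1 - gleasonDist z w ^ 2) ≤ ∏ i, coordDefect z w i ^ α := by
  set y := ENNReal.ofReal (1 - gleasonDist z w ^ 2)
  have hy : y ≤ 1 := ENNReal.ofReal_le_one.2 (by nlinarith [sq_nonneg (gleasonDist z w)])
  calc y = y ^ (1 : ℝ) := (ENNReal.rpow_one y).symm
    _ ≤ y ^ (α * d) := ENNReal.rpow_le_rpow_of_exponent_ge hy (by linarith)
    _ = ∏ _i : Fin d, y ^ α := by simp [ENNReal.rpow_mul]
    _ ≤ _ := Finset.prod_le_prod' fun i _ => ENNReal.rpow_le_rpow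
        (ofReal_one_sub_gleasonDist_sq_le_coordDefect z w i) hα

end Gleason

/-! ### Deterministic criteria for separation. -/

section Separation

variable {d : ℕ} {Z : ℕ → Polydisc d}

lemma weaklySeparated_of_finite (hinj : ∀ n k, n ≠ k → Z n ≠ Z k) {c : ℝ} (hc : 0 < c)
    (hfin : {p : ℕ × ℕ | p.1 ≠ p.2 ∧ gleasonDist (Z p.1) (Z p.2) < c}.Finite) :
    WeaklySeparated Z := by
  rcases hfin.toFinset.eq_empty_or_nonempty with he | hne
  · refine ⟨c, hc, fun n k hnk => ?_⟩
    by_contra! hlt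
    have : (n, k) ∈ hfin.toFinset := hfin.mem_toFinset.2 ⟨hnk, hlt⟩
    simp [he] at this
  · obtain ⟨q, hq, hmin⟩ := hfin.toFinset.exists_min_image
      (fun p => gleasonDist (Z p.1) (Z p.2)) hne
    have hq' := hfin.mem_toFinset.1 hq
    refine ⟨gleasonDist (Z q.1) (Z q.2), gleasonDist_pos (hinj _ _ hq'.1), fun n k hnk => ?_⟩
    by_cases hlt : gleasonDist (Z n) (Z k) < c
    · exact hmin (n, k) (hfin.mem_toFinset.2 ⟨hnk, hlt⟩)
    · exact hq'.2.le.trans (not_lt.1 hlt)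

/-- A summable off-diagonal quantity that controls `(1 - ρ_G²)^d` yields weak separation. -/
lemma weaklySeparated_of_tsum_ne_top (hinj : ∀ n k, n ≠ k → Z n ≠ Z k) {F : ℕ → ℕ → ℝ≥0∞}
    (hF : ∑' n, ∑' k, F n k ≠ ∞)
    (hle : ∀ n k, n ≠ k → ENNReal.ofReal (1 - gleasonDist (Z n) (Z k) ^ 2) ^ d ≤ F n k) :
    WeaklySeparated Z := by
  rw [← ENNReal.tsum_prod] at hF
  -- A pair with `ρ_G < 1/2` has `1 - ρ_G² > 3/4`, so its term is at least `2^{-d}`.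
  have hfin := ENNReal.finite_const_le_of_tsum_ne_top hF (ε := (2⁻¹ : ℝ≥0∞) ^ d) (by simp)
  refine weaklySeparated_of_finite hinj (c := 1 / 2) (by norm_num) (hfin.subset ?_)
  rintro ⟨n, k⟩ ⟨hnk, hlt⟩
  refine le_trans ?_ (hle n k hnk)
  gcongr
  rw [ENNReal.le_ofReal_iff_toReal_le (by simp)
    (by nlinarith [gleasonDist_nonneg (Z n) (Z k), gleasonDist_le_one (Z n) (Z k)])]
  simp only [ENNReal.toReal_inv, ENNReal.toReal_ofNat]
  have : gleasonDist (Z n) (Z k) < 1 / 2 := hlt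
  nlinarith [gleasonDist_nonneg (Z n) (Z k)]

/-- By weak separation, `-log ρ² ≤ (1 - ρ²)/ρ² ≤ (1 - ρ²)/δ²`, so a summable defect bounds every
finite product below by the same constant, uniformly in `n`. -/
lemma uniformlySeparated_of_tsum_ne_top (hw : WeaklySeparated Z)
    (hS : ∑' n, ∑' k, (if n = k then 0 else
      ENNReal.ofReal (1 - gleasonDist (Z n) (Z k) ^ 2)) ≠ ∞) :
    UniformlySeparated Z := by
  obtain ⟨δ, hδ, hsep⟩ := hw
  set S := ∑' n, ∑' k, (if n = k then 0 else
      ENNReal.ofReal (1 - gleasonDist (Z n) (Z k) ^ 2)) with hSdef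
  refine ⟨Real.exp (-(S.toReal / δ ^ 2)), Real.exp_pos _, fun n => ?_⟩
  have hfac : ∀ k, k ≠ n → Real.exp (-((1 - gleasonDist (Z n) (Z k) ^ 2) / δ ^ 2)) ≤
      gleasonDist (Z n) (Z k) := by
    intro k hk
    set ρ := gleasonDist (Z n) (Z k)
    have h1 : δ ≤ ρ := hsep n k hk.symm
    have h2 : ρ ≤ 1 := gleasonDist_le_one _ _
    have hρ : 0 < ρ := hδ.trans_le h1
    have h3 := Real.one_sub_inv_le_log_of_pos (pow_pos hρ 2)
    have h4 : (1 - ρ ^ 2) / ρ ^ 2 ≤ (1 - ρ ^ 2) / δ ^ 2 :=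
      div_le_div_of_nonneg_left (by nlinarith) (by positivity) (pow_le_pow_left₀ hδ.le h1 2)
    have h5 : (1 - ρ ^ 2) / ρ ^ 2 = (ρ ^ 2)⁻¹ - 1 := by field_simp
    calc Real.exp (-((1 - ρ ^ 2) / δ ^ 2)) ≤ Real.exp (Real.log (ρ ^ 2)) :=
          Real.exp_le_exp.2 (by linarith)
      _ = ρ ^ 2 := Real.exp_log (by positivity)
      _ ≤ ρ := by nlinarith
  have hfin : ∀ s : Finset {k : ℕ // k ≠ n},
      Real.exp (-(S.toReal / δ ^ 2)) ≤ ∏ k ∈ s, gleasonDist (Z n) (Z k) := by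
    intro s
    have hsum : ∑ k ∈ s, (1 - gleasonDist (Z n) (Z k) ^ 2) ≤ S.toReal := by
      have h0 : ∀ k, 0 ≤ 1 - gleasonDist (Z n) (Z k) ^ 2 := fun k => by
        nlinarith [gleasonDist_nonneg (Z n) (Z k), gleasonDist_le_one (Z n) (Z k)]
      rw [← ENNReal.ofReal_le_iff_le_toReal hS, ENNReal.ofReal_sum_of_nonneg (fun k _ => h0 k.1)]
      have e : ∀ k : {k : ℕ // k ≠ n}, ENNReal.ofReal (1 - gleasonDist (Z n) (Z k) ^ 2) =
          if n = k then 0 else ENNReal.ofReal (1 - gleasonDist (Z n) (Z k) ^ 2) := fun k => by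
        rw [if_neg k.2.symm]
      rw [Finset.sum_congr rfl fun k _ => e k]
      refine (ENNReal.sum_le_tsum s).trans ?_
      refine (ENNReal.tsum_comp_le_tsum_of_injective Subtype.val_injective (fun k : ℕ =>
        if n = k then 0 else ENNReal.ofReal (1 - gleasonDist (Z n) (Z k) ^ 2))).trans ?_
      exact ENNReal.le_tsum (f := fun n => ∑' k, (if n = k then 0 else
        ENNReal.ofReal (1 - gleasonDist (Z n) (Z k) ^ 2))) n
    calc Real.exp (-(S.toReal / δ ^ 2))
        ≤ Real.exp (∑ k ∈ s, -((1 - gleasonDist (Z n) (Z k) ^ 2) / δ ^ 2)) := by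
          rw [Real.exp_le_exp, Finset.sum_neg_distrib, ← Finset.sum_div]
          gcongr
      _ = ∏ k ∈ s, Real.exp (-((1 - gleasonDist (Z n) (Z k) ^ 2) / δ ^ 2)) := Real.exp_sum _ _
      _ ≤ _ := Finset.prod_le_prod (fun _ _ => (Real.exp_pos _).le) fun k _ => hfac k k.2
  -- Partial products decrease, so the infinite product truly converges to their infimum; the
  -- default value of `tprod` plays no role.
  have hanti : Antitone fun s : Finset {k : ℕ // k ≠ n} => ∏ k ∈ s, gleasonDist (Z n) (Z k) := by
    intro s t hst
    exact Finset.prod_le_prod_of_subset_of_le_one hst (fun _ _ => gleasonDist_nonneg _ _)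
      fun _ _ _ => gleasonDist_le_one _ _
  have hprod : HasProd (fun k : {k : ℕ // k ≠ n} => gleasonDist (Z n) (Z k))
      (⨅ s : Finset {k : ℕ // k ≠ n}, ∏ k ∈ s, gleasonDist (Z n) (Z k)) := by
    have := tendsto_atTop_ciInf hanti ⟨0, by
      rintro _ ⟨s, rfl⟩
      exact Finset.prod_nonneg fun _ _ => gleasonDist_nonneg _ _⟩
    simpa [HasProd] using this
  rw [hprod.tprod_eq]
  exact le_ciInf hfin

end Separation

/-! ### Carleson measures from a Hilbert-Schmidt Gram matrix. -/

section Carleson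

variable {d : ℕ}

lemma inner_kerFun_szego (z w : Polydisc d) :
    inner ℂ (RKHS.kerFun (HardySpace d) z 1) (RKHS.kerFun (HardySpace d) w 1) = szego d z w := by
  rw [RKHS.kerFun_inner, RKHS.kerFun_apply, hardySpace_kernel]
  simp [szegoKernel]

lemma mul_norm_szego_sq (z w : Polydisc d) :
    (∏ i, (1 - ‖z.1 i‖ ^ 2)) * (∏ i, (1 - ‖w.1 i‖ ^ 2)) * ‖szego d z w‖ ^ 2 =
      ∏ i, (1 - pseudoHyperbolicDist (z.1 i) (w.1 i) ^ 2) := by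
  rw [szego, norm_prod, ← Finset.prod_pow, ← Finset.prod_mul_distrib, ← Finset.prod_mul_distrib]
  refine Finset.prod_congr rfl fun i _ => ?_
  have h : ‖1 - z.1 i * conj (w.1 i)‖ = ‖1 - conj (z.1 i) * w.1 i‖ := by
    rw [← RCLike.norm_conj]; simp
  rw [one_sub_pseudoHyperbolicDist_sq (z.2 i) (w.2 i), norm_inv, h, inv_pow, div_eq_mul_inv]

/-- The normalized Gram matrix is the identity plus an off-diagonal part whose squared
Hilbert-Schmidt norm is at most the given sum. It is thus bounded, and the `T T*` argument moves the
bound to the restriction map. -/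
lemma isCarlesonMeasure_sequenceMeasure {Z : ℕ → Polydisc d}
    (hS : ∑' n, ∑' k, (if n = k then 0 else ∏ i, coordDefect (Z n) (Z k) i) ≠ ∞) :
    IsCarlesonMeasure (HardySpace d) (sequenceMeasure Z) := by
  set S := ∑' n, ∑' k, (if n = k then 0 else ∏ i, coordDefect (Z n) (Z k) i) with hSdef
  set H := S.toReal
  have hH : 0 ≤ H := ENNReal.toReal_nonneg
  set a : ℕ → ℝ := fun n => ∏ i, (1 - ‖(Z n).1 i‖ ^ 2) with ha
  have ha0 : ∀ n, 0 ≤ a n := fun n => Finset.prod_nonneg fun i _ => by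
    nlinarith [(Z n).2 i, norm_nonneg ((Z n).1 i)]
  -- The diagonal contributes `1`, the off-diagonal Hilbert-Schmidt norm `√H`.
  set c : ℝ := 1 + √H with hc
  have hc0 : 0 < c := by positivity
  have hself : ∀ n, a n * ‖szego d (Z n) (Z n)‖ = 1 := by
    intro n
    have h := mul_norm_szego_sq (Z n) (Z n)
    have h1 : a n * a n * ‖szego d (Z n) (Z n)‖ ^ 2 = 1 := by
      rw [h]; simp [pseudoHyperbolicDist]
    have h2 : 0 ≤ a n * ‖szego d (Z n) (Z n)‖ := mul_nonneg (ha0 n) (norm_nonneg _)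
    nlinarith
  have hoff : ∀ s : Finset ℕ, ∑ p ∈ s.offDiag, a p.1 * a p.2 * ‖szego d (Z p.1) (Z p.2)‖ ^ 2 ≤
      H := by
    intro s
    have h0 : ∀ (z w : Polydisc d) i, 0 ≤ 1 - pseudoHyperbolicDist (z.1 i) (w.1 i) ^ 2 :=
      fun z w i => by
        nlinarith [pseudoHyperbolicDist_nonneg (z.1 i) (w.1 i),
          pseudoHyperbolicDist_le_one (z.2 i) (w.2 i)]
    rw [← ENNReal.ofReal_le_iff_le_toReal hS, ENNReal.ofReal_sum_of_nonneg fun p _ =>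
      mul_nonneg (mul_nonneg (ha0 _) (ha0 _)) (by positivity)]
    calc _ = ∑ p ∈ s.offDiag,
          (if p.1 = p.2 then 0 else ∏ i, coordDefect (Z p.1) (Z p.2) i) := by
          refine Finset.sum_congr rfl fun p hp => ?_
          rw [if_neg (Finset.mem_offDiag.1 hp).2.2, mul_norm_szego_sq,
            ENNReal.ofReal_prod_of_nonneg fun i _ => h0 _ _ i]
          rfl
      _ ≤ ∑' p : ℕ × ℕ, (if p.1 = p.2 then 0 else ∏ i, coordDefect (Z p.1) (Z p.2) i) :=
          ENNReal.sum_le_tsum _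
      _ = S := by
          rw [hSdef, ← ENNReal.tsum_prod]
  have hfinite : ∀ (f : HardySpace d) (s : Finset ℕ), ∑ n ∈ s, a n * ‖f (Z n)‖ ^ 2 ≤
      c * ‖f‖ ^ 2 := by
    intro f s
    set A := ∑ n ∈ s, a n * ‖f (Z n)‖ ^ 2 with hA
    have hA0 : 0 ≤ A := Finset.sum_nonneg fun n _ => mul_nonneg (ha0 n) (by positivity)
    -- The adjoint of restriction applied to the restriction of `f`. Then `⟨g, f⟩ = A`, while `‖g‖²`
    -- is a quadratic form of the Gram matrix, bounded by `c A`; together, `A² ≤ c A ‖f‖²`.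
    set g : HardySpace d := ∑ n ∈ s, ((a n : ℂ) * f (Z n)) • RKHS.kerFun (HardySpace d) (Z n) 1
      with hg
    have hgf : inner ℂ g f = (A : ℂ) := by
      rw [hg, sum_inner, hA]
      push_cast
      refine Finset.sum_congr rfl fun n _ => ?_
      rw [inner_smul_left, RKHS.kerFun_inner]
      simp only [map_mul, Complex.conj_ofReal, RCLike.inner_apply, map_one, mul_one]
      rw [mul_assoc, RCLike.conj_mul]
      rfl
    have h1 : A ≤ ‖g‖ * ‖f‖ := by
      have := norm_inner_le_norm (𝕜 := ℂ) g f
      rwa [hgf, Complex.norm_real, Real.norm_eq_abs, abs_of_nonneg hA0] at this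
    have h2 : ‖g‖ ^ 2 ≤ A * c := by
      have e1 : (‖g‖ ^ 2 : ℝ) = ‖(inner ℂ g g : ℂ)‖ := by
        rw [inner_self_eq_norm_sq_to_K]; simp
      have e2 : (inner ℂ g g : ℂ) = ∑ n ∈ s, ∑ k ∈ s,
          conj ((a n : ℂ) * f (Z n)) * ((a k : ℂ) * f (Z k)) * szego d (Z n) (Z k) := by
        conv_lhs => rw [hg]
        rw [sum_inner]
        refine Finset.sum_congr rfl fun n _ => ?_
        rw [inner_sum]
        refine Finset.sum_congr rfl fun k _ => ?_
        rw [inner_smul_left, inner_smul_right, inner_kerFun_szego]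
        ring
      have e3 : ‖g‖ ^ 2 ≤ ∑ p ∈ s ×ˢ s,
          a p.1 * ‖f (Z p.1)‖ * (a p.2 * ‖f (Z p.2)‖) * ‖szego d (Z p.1) (Z p.2)‖ := by
        rw [e1, e2, ← Finset.sum_product']
        refine (norm_sum_le _ _).trans (Finset.sum_le_sum fun p _ => le_of_eq ?_)
        simp only [norm_mul, RCLike.norm_conj, Complex.norm_real, Real.norm_eq_abs,
          abs_of_nonneg (ha0 _)]
      have e4 : ∑ p ∈ s.diag,
          a p.1 * ‖f (Z p.1)‖ * (a p.2 * ‖f (Z p.2)‖) * ‖szego d (Z p.1) (Z p.2)‖ = A := by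
        rw [Finset.sum_diag]
        refine Finset.sum_congr rfl fun n _ => ?_
        linear_combination (a n * ‖f (Z n)‖ ^ 2) * hself n
      -- Cauchy-Schwarz over pairs, after splitting each weight as `√a · √a` between the values of
      -- `f` and the kernel.
      have e5 : ∑ p ∈ s.offDiag,
          a p.1 * ‖f (Z p.1)‖ * (a p.2 * ‖f (Z p.2)‖) * ‖szego d (Z p.1) (Z p.2)‖ ≤ A * √H := by
        refine Real.le_sqrt_of_sq_le (x := _) (y := A ^ 2 * H) ?_ |>.trans_eq ?_
        · have e6 : ∑ p ∈ s.offDiag,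
              (√(a p.1) * ‖f (Z p.1)‖ * (√(a p.2) * ‖f (Z p.2)‖)) ^ 2 ≤ A ^ 2 := by
            rw [sq A, hA, Finset.sum_mul_sum, ← Finset.sum_product']
            refine (Finset.sum_le_sum_of_subset_of_nonneg
              (fun p hp => Finset.mem_product.2
                ⟨(Finset.mem_offDiag.1 hp).1, (Finset.mem_offDiag.1 hp).2.1⟩)
              fun _ _ _ => sq_nonneg _).trans_eq ?_
            refine Finset.sum_congr rfl fun p _ => ?_
            rw [mul_pow, mul_pow, mul_pow, Real.sq_sqrt (ha0 _), Real.sq_sqrt (ha0 _)]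
          have e7 : ∑ p ∈ s.offDiag,
              (√(a p.1) * √(a p.2) * ‖szego d (Z p.1) (Z p.2)‖) ^ 2 ≤ H := by
            refine le_trans (le_of_eq ?_) (hoff s)
            refine Finset.sum_congr rfl fun p _ => ?_
            rw [mul_pow, mul_pow, Real.sq_sqrt (ha0 _), Real.sq_sqrt (ha0 _)]
          have e8 : ∀ p : ℕ × ℕ,
              a p.1 * ‖f (Z p.1)‖ * (a p.2 * ‖f (Z p.2)‖) * ‖szego d (Z p.1) (Z p.2)‖ =
              (√(a p.1) * ‖f (Z p.1)‖ * (√(a p.2) * ‖f (Z p.2)‖)) *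
              (√(a p.1) * √(a p.2) * ‖szego d (Z p.1) (Z p.2)‖) := by
            intro p
            have h3 := Real.mul_self_sqrt (ha0 p.1)
            have h4 := Real.mul_self_sqrt (ha0 p.2)
            conv_lhs => rw [← h3, ← h4]
            ring
          simp only [e8]
          refine (Finset.sum_mul_sq_le_sq_mul_sq _ _ _).trans ?_
          exact mul_le_mul e6 e7 (Finset.sum_nonneg fun _ _ => by positivity) (by positivity)
        · rw [Real.sqrt_mul (by positivity), Real.sqrt_sq hA0]
      rw [← Finset.diag_union_offDiag, Finset.sum_union (Finset.disjoint_diag_offDiag _)] at e3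
      rw [hc]
      linarith
    rcases hA0.eq_or_lt with h0 | h0
    · rw [← h0]; positivity
    · have h3 : A * A ≤ A * (c * ‖f‖ ^ 2) := by
        have := mul_le_mul h1 h1 hA0 (by positivity)
        have := mul_le_mul_of_nonneg_right h2 (sq_nonneg ‖f‖)
        nlinarith
      exact le_of_mul_le_mul_left h3 h0
  refine ⟨√c, Real.sqrt_pos.2 hc0, fun f => ?_⟩
  rw [eLpNorm_eq_lintegral_rpow_enorm_toReal (by norm_num) (by norm_num)]
  have h1 : ∫⁻ x, ‖f x‖ₑ ^ (2 : ℝ≥0∞).toReal ∂(sequenceMeasure Z) ≤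
      ENNReal.ofReal (c * ‖f‖ ^ 2) := by
    rw [sequenceMeasure, lintegral_sum_measure]
    simp only [lintegral_smul_measure, lintegral_dirac, smul_eq_mul, ENNReal.toReal_ofNat]
    rw [ENNReal.tsum_eq_iSup_sum]
    refine iSup_le fun s => ?_
    refine le_trans (le_of_eq ?_) (ENNReal.ofReal_le_ofReal (hfinite f s))
    rw [ENNReal.ofReal_sum_of_nonneg fun n _ => mul_nonneg (ha0 n) (by positivity)]
    refine Finset.sum_congr rfl fun n _ => ?_
    rw [ENNReal.ofReal_mul (ha0 n), ENNReal.ofReal_pow (norm_nonneg _), ofReal_norm]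
    norm_cast
  refine (ENNReal.rpow_le_rpow h1 (by norm_num)).trans_eq ?_
  have e : c * ‖f‖ ^ 2 = (√c * ‖f‖) ^ 2 := by rw [mul_pow, Real.sq_sqrt hc0.le]
  rw [e, ENNReal.ofReal_pow (by positivity), ← ENNReal.rpow_natCast, ← ENNReal.rpow_mul]
  norm_num

end Carleson

/-! ### Expected defects and almost sure distinctness. -/

section RandomAngles

variable {d : ℕ} {r : ℕ → Fin d → Set.Ico (0 : ℝ) 1}

lemma norm_polarSequence (φ : ℕ → Fin d → ℝ) (n : ℕ) (i : Fin d) :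
    ‖(polarSequence r φ n).1 i‖ = r n i := by
  simp only [polarSequence]
  rw [norm_mul, Complex.norm_exp_ofReal_mul_I, mul_one, Complex.norm_real, Real.norm_eq_abs,
    abs_of_nonneg (r n i).2.1]

lemma coordDefect_polarSequence (φ : ℕ → Fin d → ℝ) (n k : ℕ) (i : Fin d) :
    coordDefect (polarSequence r φ n) (polarSequence r φ k) i =
      ENNReal.ofReal (polarDefect (r n i) (r k i) (φ k i - φ n i)) := by
  have h : conj ((polarSequence r φ n).1 i) * (polarSequence r φ k).1 i =
      ((r n i * r k i : ℝ) : ℂ) * Complex.exp ((φ k i - φ n i : ℝ) * Complex.I) := by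
    simp only [polarSequence, map_mul, Complex.conj_ofReal, ← Complex.exp_conj, Complex.conj_I]
    push_cast
    rw [show ((φ k i : ℂ) - φ n i) * Complex.I =
      (φ n i : ℂ) * -Complex.I + (φ k i : ℂ) * Complex.I by ring, Complex.exp_add]
    ring
  rw [coordDefect, one_sub_pseudoHyperbolicDist_sq ((polarSequence r φ n).2 i)
    ((polarSequence r φ k).2 i), h, norm_polarSequence, norm_polarSequence, polarDefect]

variable {Ω : Type*} [MeasurableSpace Ω] {P : Measure Ω} [IsProbabilityMeasure P]
  {θ : ℕ → Ω → Fin d → ℝ}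

lemma measurable_prod_coordDefect_rpow (hmeas : ∀ n, Measurable (θ n)) (n k : ℕ) (α : ℝ) :
    Measurable fun ω => ∏ i, coordDefect (polarSequence r (fun n => θ n ω) n)
      (polarSequence r (fun n => θ n ω) k) i ^ α := by
  simp only [coordDefect_polarSequence]
  refine Finset.measurable_prod _ fun i _ => ?_
  refine (ENNReal.measurable_ofReal.comp ((measurable_polarDefect _ _).comp ?_)).pow_const α
  exact ((measurable_pi_apply i).comp (hmeas k)).sub ((measurable_pi_apply i).comp (hmeas n))

lemma lintegral_prod_coordDefect_rpow (hmeas : ∀ n, Measurable (θ n)) (hindep : iIndepFun θ P)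
    (hlaw : ∀ n, P.map (θ n) = Measure.pi fun _ => angleLaw) {n k : ℕ} (hnk : n ≠ k) (α : ℝ) :
    ∫⁻ ω, ∏ i, coordDefect (polarSequence r (fun n => θ n ω) n)
        (polarSequence r (fun n => θ n ω) k) i ^ α ∂P =
      ∏ i, ((ENNReal.ofReal (2 * Real.pi))⁻¹ * ∫⁻ x in Set.Ioc (-Real.pi) Real.pi,
        ENNReal.ofReal (polarDefect (r n i) (r k i) x) ^ α) := by
  simp only [coordDefect_polarSequence]
  refine lintegral_prod_sub_of_indepFun (hmeas k) (hmeas n) (hlaw k)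
    (hindep.indepFun hnk.symm)
    (f := fun i x => ENNReal.ofReal (polarDefect (r n i) (r k i) x) ^ α) (fun i => ?_) fun i x => ?_
  · exact (ENNReal.measurable_ofReal.comp (measurable_polarDefect _ _)).pow_const α
  · simp only [periodic_polarDefect (r n i : ℝ) (r k i) x]

lemma ae_tsum_coordDefect_rpow_ne_top (hmeas : ∀ n, Measurable (θ n)) {α : ℝ} {B : ℕ → ℕ → ℝ≥0∞}
    (hle : ∀ n k, n ≠ k → ∫⁻ ω, ∏ i, coordDefect (polarSequence r (fun n => θ n ω) n)
        (polarSequence r (fun n => θ n ω) k) i ^ α ∂P ≤ B n k)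
    (hB : ∑' n, ∑' k, B n k ≠ ∞) :
    ∀ᵐ ω ∂P, ∑' n, ∑' k, (if n = k then 0 else ∏ i, coordDefect
      (polarSequence r (fun n => θ n ω) n) (polarSequence r (fun n => θ n ω) k) i ^ α) ≠ ∞ := by
  have hm : ∀ n k, Measurable fun ω => if n = k then 0 else ∏ i, coordDefect
      (polarSequence r (fun n => θ n ω) n) (polarSequence r (fun n => θ n ω) k) i ^ α := by
    intro n k
    split_ifs
    · exact measurable_const
    · exact measurable_prod_coordDefect_rpow hmeas n k α
  have h : ∀ᵐ ω ∂P, ∑' n, ∑' k, (if n = k then 0 else ∏ i, coordDefect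
      (polarSequence r (fun n => θ n ω) n) (polarSequence r (fun n => θ n ω) k) i ^ α) < ∞ := by
    refine ae_lt_top (Measurable.tsum fun n => Measurable.tsum (hm n)) ?_
    refine ne_top_of_le_ne_top hB ?_
    rw [lintegral_tsum fun n => (Measurable.tsum (hm n)).aemeasurable]
    refine ENNReal.tsum_le_tsum fun n => ?_
    rw [lintegral_tsum fun k => (hm n k).aemeasurable]
    refine ENNReal.tsum_le_tsum fun k => ?_
    by_cases hnk : n = k
    · simp [hnk]
    · simpa only [if_neg hnk] using hle n k hnk
  filter_upwards [h] with ω hω using hω.ne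

lemma ae_tsum_coordDefect_ne_top (hmeas : ∀ n, Measurable (θ n)) (hindep : iIndepFun θ P)
    (hlaw : ∀ n, P.map (θ n) = Measure.pi fun _ => angleLaw) (h : weakSum r ≠ ∞) :
    ∀ᵐ ω ∂P, ∑' n, ∑' k, (if n = k then 0 else ∏ i, coordDefect
      (polarSequence r (fun n => θ n ω) n) (polarSequence r (fun n => θ n ω) k) i) ≠ ∞ := by
  set c : ℝ≥0∞ := (ENNReal.ofReal (2 * Real.pi))⁻¹ * ENNReal.ofReal (8 * Real.pi ^ 2)
  have hc : c ≠ ∞ :=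
    ENNReal.mul_ne_top (ENNReal.inv_ne_top.2 ofReal_two_pi_ne_zero) ENNReal.ofReal_ne_top
  have := ae_tsum_coordDefect_rpow_ne_top (P := P) (r := r) hmeas (α := 1)
    (B := fun n k => c ^ d * ∏ i, ENNReal.ofReal (min (1 - (r n i : ℝ)) (1 - r k i))) ?_ ?_
  · simpa only [ENNReal.rpow_one] using this
  · intro n k hnk
    rw [lintegral_prod_coordDefect_rpow hmeas hindep hlaw hnk]
    have e : c ^ d = ∏ _i : Fin d, c := by simp
    rw [e, ← Finset.prod_mul_distrib]
    refine Finset.prod_le_prod' fun i _ => ?_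
    simp only [ENNReal.rpow_one]
    rw [mul_assoc, ← ENNReal.ofReal_mul (by positivity)]
    exact mul_le_mul_right (lintegral_polarDefect_le (r n i).2 (r k i).2) _
  · simp only [ENNReal.tsum_mul_left]
    exact ENNReal.mul_ne_top (ENNReal.pow_ne_top hc) (tsum_tsum_prod_min_ne_top h)

lemma ae_tsum_coordDefect_rpow_ne_top_of_strongSum (hd : 1 ≤ d) (hmeas : ∀ n, Measurable (θ n))
    (hindep : iIndepFun θ P) (hlaw : ∀ n, P.map (θ n) = Measure.pi fun _ => angleLaw)
    (h : strongSum r ≠ ∞) {α : ℝ} (hα : 1 / ((d : ℝ) + 1) < α) (hα2 : α < 1 / 2) :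
    ∀ᵐ ω ∂P, ∑' n, ∑' k, (if n = k then 0 else ∏ i, coordDefect
      (polarSequence r (fun n => θ n ω) n) (polarSequence r (fun n => θ n ω) k) i ^ α) ≠ ∞ := by
  obtain ⟨C, hC, hCle⟩ := lintegral_polarDefect_rpow_le (lt_trans (by positivity) hα) hα2
  set c : ℝ≥0∞ := (ENNReal.ofReal (2 * Real.pi))⁻¹ * C
  have hc : c ≠ ∞ := ENNReal.mul_ne_top (ENNReal.inv_ne_top.2 ofReal_two_pi_ne_zero) hC
  refine ae_tsum_coordDefect_rpow_ne_top (P := P) (r := r) hmeas (α := α)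
    (B := fun n k => c ^ d * ((∏ i, ENNReal.ofReal (1 - (r n i : ℝ)) ^ α) *
      ∏ i, ENNReal.ofReal (1 - (r k i : ℝ)) ^ α)) ?_ ?_
  · intro n k hnk
    rw [lintegral_prod_coordDefect_rpow hmeas hindep hlaw hnk]
    have e : c ^ d = ∏ _i : Fin d, c := by simp
    rw [e, ← Finset.prod_mul_distrib, ← Finset.prod_mul_distrib]
    refine Finset.prod_le_prod' fun i _ => ?_
    rw [mul_assoc]
    exact mul_le_mul_right (hCle _ (r n i).2 _ (r k i).2) _
  · have hfin := tsum_prod_rpow_ne_top hd h hα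
    simp only [ENNReal.tsum_mul_left, ENNReal.tsum_mul_right]
    exact ENNReal.mul_ne_top (ENNReal.pow_ne_top hc) (ENNReal.mul_ne_top hfin hfin)

/-- The formula for product functions is applied to the indicator of `2πℤ` in coordinate `i` and to
`1` elsewhere; the factor at `i` vanishes as `2πℤ` meets one period in a single point. -/
lemma ae_exp_sub_ne_one (hmeas : ∀ n, Measurable (θ n)) (hindep : iIndepFun θ P)
    (hlaw : ∀ n, P.map (θ n) = Measure.pi fun _ => angleLaw) {n k : ℕ} (hnk : n ≠ k) (i : Fin d) :
    ∀ᵐ ω ∂P, Complex.exp ((θ n ω i - θ k ω i : ℝ) * Complex.I) ≠ 1 := by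
  set A : Set ℝ := {x | Complex.exp ((x : ℝ) * Complex.I) = 1} with hA
  have hAm : MeasurableSet A := by
    have : Continuous fun x : ℝ => Complex.exp (x * Complex.I) := by fun_prop
    exact (isClosed_singleton.preimage this).measurableSet
  set f : Fin d → ℝ → ℝ≥0∞ := fun j => if j = i then A.indicator 1 else 1 with hf
  have hfm : ∀ j, Measurable (f j) := fun j => by
    simp only [hf]
    split_ifs
    · exact measurable_one.indicator hAm
    · exact measurable_one
  have hper : ∀ j, Function.Periodic (f j) (2 * Real.pi) := fun j x => by
    have h : x + 2 * Real.pi ∈ A ↔ x ∈ A := by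
      simp only [hA, Set.mem_ofPred_eq]
      push_cast
      rw [add_mul, Complex.exp_periodic]
    simp only [hf]
    split_ifs
    · by_cases hx : x ∈ A
      · rw [Set.indicator_of_mem hx, Set.indicator_of_mem (h.2 hx)]; rfl
      · rw [Set.indicator_of_notMem hx, Set.indicator_of_notMem (mt h.1 hx)]
    · rfl
  have hsub : A ∩ Set.Ioc (-Real.pi) Real.pi ⊆ {0} := by
    rintro x ⟨hx, h1, h2⟩
    obtain ⟨m, hm⟩ := Complex.exp_eq_one_iff.1 hx
    have hm' : x = m * (2 * Real.pi) := by
      have := congrArg Complex.im hm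
      simpa using this
    have hπ := Real.pi_pos
    have hm1 : (-1 : ℝ) < m := by nlinarith
    have hm2 : (m : ℝ) < 1 := by nlinarith
    have hm0 : m = 0 := by
      have h3 : (-1 : ℤ) < m := by exact_mod_cast hm1
      have h4 : m < (1 : ℤ) := by exact_mod_cast hm2
      omega
    rw [Set.mem_singleton_iff, hm', hm0]; simp
  have hzero : ∫⁻ x in Set.Ioc (-Real.pi) Real.pi, f i x = 0 := by
    simp only [hf, if_true]
    rw [lintegral_indicator_one hAm, Measure.restrict_apply hAm]
    exact measure_mono_null hsub (by simp)
  have hint := lintegral_prod_sub_of_indepFun (hmeas n) (hmeas k) (hlaw n) (hindep.indepFun hnk)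
    hfm hper
  have hm : Measurable fun ω => ∏ j, f j (θ n ω j - θ k ω j) :=
    Finset.measurable_prod _ fun j _ => (hfm j).comp
      (((measurable_pi_apply j).comp (hmeas n)).sub ((measurable_pi_apply j).comp (hmeas k)))
  rw [Finset.prod_eq_zero (Finset.mem_univ i) (by rw [hzero, mul_zero]),
    lintegral_eq_zero_iff hm] at hint
  filter_upwards [hint] with ω hω hexp
  have h1 : ∏ j, f j (θ n ω j - θ k ω j) = 1 := by
    refine Finset.prod_eq_one fun j _ => ?_
    simp only [hf]
    split_ifs with hj
    · subst hj
      exact Set.indicator_of_mem (s := A) hexp _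
    · rfl
  rw [h1] at hω
  exact one_ne_zero hω

/-- Coinciding points have equal radii, and in any coordinate of nonzero radius their angles agree,
a null event. So both radius vectors would be zero, which is the case excluded by `hr`. -/
lemma ae_polarSequence_injective (hmeas : ∀ n, Measurable (θ n)) (hindep : iIndepFun θ P)
    (hlaw : ∀ n, P.map (θ n) = Measure.pi fun _ => angleLaw)
    (hr : {n : ℕ | ∀ i, (r n i : ℝ) = 0}.Subsingleton) :
    ∀ᵐ ω ∂P, ∀ n k, n ≠ k →
      polarSequence r (fun n => θ n ω) n ≠ polarSequence r (fun n => θ n ω) k := by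
  have h : ∀ᵐ ω ∂P, ∀ n k, n ≠ k → ∀ i,
      Complex.exp ((θ n ω i - θ k ω i : ℝ) * Complex.I) ≠ 1 := by
    rw [ae_all_iff]; intro n
    rw [ae_all_iff]; intro k
    by_cases hnk : n = k
    · exact ae_of_all _ fun _ h => absurd hnk h
    · filter_upwards [ae_all_iff.2 fun i => ae_exp_sub_ne_one hmeas hindep hlaw hnk i] with ω hω _
      exact hω
  filter_upwards [h] with ω hω n k hnk heq
  have hval : ∀ i, (r n i : ℝ) = r k i ∧ (r n i : ℝ) = 0 := by
    intro i
    have hi : (polarSequence r (fun n => θ n ω) n).1 i = (polarSequence r (fun n => θ n ω) k).1 i :=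
      by rw [heq]
    have hn : (r n i : ℝ) = r k i := by
      rw [← norm_polarSequence (fun n => θ n ω) n i, hi, norm_polarSequence]
    refine ⟨hn, ?_⟩
    by_contra h0
    refine hω n k hnk i ?_
    simp only [polarSequence, ← hn] at hi
    have h0' : ((r n i : ℝ) : ℂ) ≠ 0 := by exact_mod_cast h0
    have := mul_left_cancel₀ h0' hi
    push_cast
    rw [sub_mul, Complex.exp_sub, this, div_self (Complex.exp_ne_zero _)]
  exact hnk (hr (fun i => (hval i).2) fun i => (hval i).1 ▸ (hval i).2)

end RandomAngles

/-! ### The birthday problem with labels. -/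

section Birthday

/-- The configurations in which no two indices with equal labels have equal values. -/
def collisionFree {ι σ : Type*} (s : ℕ → σ) (n : ℕ) : Set (Finset.range n → ι) :=
  {y | ∀ j k : Finset.range n, (k : ℕ) < j → s k = s j → y k ≠ y j}

variable {Ω : Type*} [MeasurableSpace Ω] {P : Measure Ω} [IsProbabilityMeasure P]
  {ι σ : Type*} [Countable ι] [MeasurableSpace ι] [MeasurableSingletonClass ι] [DecidableEq σ]
  {X : ℕ → Ω → ι} {s : ℕ → σ} {B : σ → Finset ι} {p : σ → ℝ}

/-- Without earlier collisions, the values at earlier indices with the label of `n` are distinct, so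
at most one of them equals `X n`. Each such coincidence has probability `p (s n)` given the past,
since `X n` is independent of the past and charges every point of the box equally. -/
lemma measureReal_collisionFree_succ (hX : ∀ n, Measurable (X n)) (hindep : iIndepFun X P)
    (hB : ∀ n, ∀ᵐ ω ∂P, X n ω ∈ B (s n))
    (hp : ∀ n, ∀ Q ∈ B (s n), P.real (X n ⁻¹' {Q}) = p (s n)) (n : ℕ) :
    P.real ((fun ω (j : Finset.range (n + 1)) => X j ω) ⁻¹' collisionFree s (n + 1)) =
      P.real ((fun ω (j : Finset.range n) => X j ω) ⁻¹' collisionFree s n) *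
        (1 - ((Finset.range n).filter fun k => s k = s n).card * p (s n)) := by
  set E : Set Ω := (fun ω (j : Finset.range n) => X j ω) ⁻¹' collisionFree s n with hE
  set C : Finset ℕ := (Finset.range n).filter fun k => s k = s n with hC
  have hg : Measurable fun ω (j : Finset.range n) => X j ω := measurable_pi_lambda _ fun j => hX j
  have hEm : MeasurableSet E := hg MeasurableSet.of_discrete
  have hmE : ∀ ω, ω ∈ E ↔ ∀ j < n, ∀ k < j, s k = s j → X k ω ≠ X j ω := by
    intro ω
    constructor
    · intro h j hj k hk
      exact h ⟨j, Finset.mem_range.2 hj⟩ ⟨k, Finset.mem_range.2 (hk.trans hj)⟩ hk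
    · rintro h ⟨j, hj⟩ ⟨k, _⟩ hk
      exact h j (Finset.mem_range.1 hj) k hk
  have hEsucc : (fun ω (j : Finset.range (n + 1)) => X j ω) ⁻¹' collisionFree s (n + 1) =
      E \ ⋃ k ∈ C, E ∩ {ω | X k ω = X n ω} := by
    ext ω
    simp only [Set.mem_sdiff, Set.mem_iUnion, Set.mem_inter_iff, Set.mem_ofPred_eq, hmE, hC,
      Finset.mem_filter, Finset.mem_range, Set.mem_preimage, collisionFree, Subtype.forall]
    constructor
    · intro h
      refine ⟨fun j hj k hk => h j (by omega) k (by omega) hk, ?_⟩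
      rintro ⟨k, ⟨hk, hs⟩, -, hX⟩
      exact h n (by omega) k (by omega) hk hs hX
    · rintro ⟨h1, h2⟩ j hj k _ hkj hs hX
      rcases Nat.lt_succ_iff_lt_or_eq.1 hj with hj | rfl
      · exact h1 j hj k hkj hs hX
      · exact h2 ⟨k, ⟨hkj, hs⟩, h1, hX⟩
  have hmeq : ∀ k, MeasurableSet {ω | X k ω = X n ω} := fun k =>
    ((hX k).prodMk (hX n)) (MeasurableSet.of_discrete (s := {q : ι × ι | q.1 = q.2}))
  have hdisj : Set.PairwiseDisjoint (C : Set ℕ) fun k => E ∩ {ω | X k ω = X n ω} := by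
    have key : ∀ k ∈ C, ∀ l ∈ C, k < l → Disjoint (E ∩ {ω | X k ω = X n ω})
        (E ∩ {ω | X l ω = X n ω}) := by
      intro k hk l hl hkl
      rw [Set.disjoint_left]
      rintro ω ⟨h1, h2⟩ ⟨-, h3⟩
      simp only [hC, Finset.mem_filter, Finset.mem_range] at hk hl
      exact (hmE ω).1 h1 l hl.1 k hkl (hk.2.trans hl.2.symm) (h2.trans h3.symm)
    intro k hk l hl hkl
    rcases lt_or_gt_of_ne hkl with h | h
    · exact key k hk l hl h
    · exact (key l hl k hk h).symm
  have hind := hindep.indepFun_finset (Finset.range n) {n} (by simp) hX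
  have hone : ∀ k ∈ C, P.real (E ∩ {ω | X k ω = X n ω}) = P.real E * p (s n) := by
    intro k hk
    simp only [hC, Finset.mem_filter, Finset.mem_range] at hk
    have hmQ : ∀ Q, MeasurableSet (E ∩ X k ⁻¹' {Q}) := fun Q =>
      hEm.inter (hX k (measurableSet_singleton Q))
    have hQ : ∀ Q ∈ B (s n), P.real (E ∩ X k ⁻¹' {Q} ∩ X n ⁻¹' {Q}) =
        P.real (E ∩ X k ⁻¹' {Q}) * p (s n) := by
      intro Q hQ
      rw [← hp n Q hQ]
      have := hind.measure_inter_preimage_eq_mul (s := {y | y ∈ collisionFree s n ∧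
        y ⟨k, Finset.mem_range.2 hk.1⟩ = Q}) (t := {y | y ⟨n, by simp⟩ = Q})
        MeasurableSet.of_discrete MeasurableSet.of_discrete
      simp only [measureReal_def]
      rw [← ENNReal.toReal_mul]
      exact congrArg ENNReal.toReal this
    have hdisjQ : Set.PairwiseDisjoint (B (s n) : Set ι) fun Q => E ∩ X k ⁻¹' {Q} := by
      intro Q _ Q' _ hne
      refine Set.disjoint_left.2 ?_
      rintro ω ⟨-, h1⟩ ⟨-, h2⟩
      exact hne (h1.symm.trans h2)
    -- Equal labels give `X k` and `X n` the same box, so splitting by the value of `X k` within `B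
    -- (s n)` loses only a null set.
    have h1 : P.real E = ∑ Q ∈ B (s n), P.real (E ∩ X k ⁻¹' {Q}) := by
      rw [← measureReal_biUnion_finset hdisjQ fun Q _ => hmQ Q]
      refine measureReal_congr ?_
      filter_upwards [hB k] with ω hω
      rw [hk.2] at hω
      refine propext ⟨fun h => ?_, fun h => ?_⟩
      · exact Set.mem_biUnion hω ⟨h, rfl⟩
      · obtain ⟨Q, _, h, _⟩ := Set.mem_iUnion₂.1 h
        exact h
    have h2 : P.real (E ∩ {ω | X k ω = X n ω}) =
        ∑ Q ∈ B (s n), P.real (E ∩ X k ⁻¹' {Q} ∩ X n ⁻¹' {Q}) := by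
      rw [← measureReal_biUnion_finset
        (hdisjQ.mono fun Q => Set.inter_subset_left)
        fun Q _ => (hmQ Q).inter (hX n (measurableSet_singleton Q))]
      refine measureReal_congr ?_
      filter_upwards [hB k] with ω hω
      rw [hk.2] at hω
      refine propext ⟨fun h => ?_, fun h => ?_⟩
      · exact Set.mem_biUnion hω ⟨⟨h.1, rfl⟩, h.2.symm⟩
      · obtain ⟨Q, _, ⟨h, h3⟩, h4⟩ := Set.mem_iUnion₂.1 h
        exact ⟨h, h3.trans h4.symm⟩
    rw [h2, Finset.sum_congr rfl hQ, ← Finset.sum_mul, ← h1]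
  have hU : MeasurableSet (⋃ k ∈ C, E ∩ {ω | X k ω = X n ω}) :=
    Finset.measurableSet_biUnion _ fun k _ => hEm.inter (hmeq k)
  rw [hEsucc, measureReal_sdiff (Set.iUnion₂_subset fun k _ => Set.inter_subset_left) hU,
    measureReal_biUnion_finset hdisj (fun k _ => hEm.inter (hmeq k)), Finset.sum_congr rfl hone,
    Finset.sum_const, nsmul_eq_mul]
  ring

/-- Independent variables, uniform on a box that depends only on a label, almost surely collide
within a label once the sum of the conditional collision probabilities diverges. -/
lemma ae_exists_collision (hX : ∀ n, Measurable (X n)) (hindep : iIndepFun X P)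
    (hB : ∀ n, ∀ᵐ ω ∂P, X n ω ∈ B (s n))
    (hp : ∀ n, ∀ Q ∈ B (s n), P.real (X n ⁻¹' {Q}) = p (s n)) (hp0 : ∀ n, 0 ≤ p (s n))
    (hsum : ¬ Summable fun n => (((Finset.range n).filter fun k => s k = s n).card : ℝ) * p (s n)) :
    ∀ᵐ ω ∂P, ∃ j k, k < j ∧ s k = s j ∧ X k ω = X j ω := by
  set c : ℕ → ℝ := fun n => (((Finset.range n).filter fun k => s k = s n).card : ℝ) * p (s n)
    with hc
  have hbound : ∀ n, P.real ((fun ω (j : Finset.range n) => X j ω) ⁻¹' collisionFree s n) ≤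
      Real.exp (-∑ j ∈ Finset.range n, c j) := by
    intro n
    induction n with
    | zero => simp
    | succ n ih =>
      rw [measureReal_collisionFree_succ hX hindep hB hp, Finset.sum_range_succ, neg_add,
        Real.exp_add]
      have h1 : 1 - c n ≤ Real.exp (-c n) := by linarith [Real.add_one_le_exp (-c n)]
      refine (mul_le_mul_of_nonneg_left h1 measureReal_nonneg).trans ?_
      exact mul_le_mul_of_nonneg_right ih (Real.exp_pos _).le
  have htend : Tendsto (fun n => Real.exp (-∑ j ∈ Finset.range n, c j)) atTop (𝓝 0) :=
    Real.tendsto_exp_neg_atTop_nhds_zero.comp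
      ((not_summable_iff_tendsto_nat_atTop_of_nonneg fun n =>
        mul_nonneg (Nat.cast_nonneg _) (hp0 n)).1 hsum)
  have hset : {ω | ¬ ∃ j k, k < j ∧ s k = s j ∧ X k ω = X j ω} =
      ⋂ n, (fun ω (j : Finset.range n) => X j ω) ⁻¹' collisionFree s n := by
    ext ω
    simp only [Set.mem_ofPred_eq, Set.mem_iInter, Set.mem_preimage, collisionFree, Subtype.forall]
    push Not
    constructor
    · intro h n j _ k _ hkj hs
      exact h j k hkj hs
    · intro h j k hkj hs
      exact h (j + 1) j (by simp) k (by simp; omega) hkj hs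
  rw [ae_iff, hset, ← measureReal_eq_zero_iff]
  refine le_antisymm (ge_of_tendsto' htend fun n => ?_) measureReal_nonneg
  exact (measureReal_mono (Set.iInter_subset _ n)).trans (hbound n)

end Birthday

/-! ### Counting pairs within refined shells. -/

section PairCount

/-- For `N` elements the sum counts the `N(N-1)/2` pairs, and `N² ≤ 3N(N-1)/2 + 1` for every natural
`N`. Passing to the supremum over initial segments covers infinite `S`. -/
lemma encard_sq_le (S : Set ℕ) [DecidablePred (· ∈ S)] :
    (S.encard : ℝ≥0∞) ^ 2 ≤
      3 * ∑' n : S, (((Finset.range n).filter (· ∈ S)).card : ℝ≥0∞) + 1 := by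
  set c : ℕ → ℕ := fun n => ((Finset.range n).filter (· ∈ S)).card with hc
  set T := ∑' n : S, (c n : ℝ≥0∞) with hT
  have hnat : ∀ j, c j ^ 2 ≤ 3 * ∑ n ∈ Finset.range j with n ∈ S, c n + 1 := by
    intro j
    induction j with
    | zero => simp [hc]
    | succ j ih =>
      by_cases hj : j ∈ S
      · have e : c (j + 1) = c j + 1 := by simp [hc, Finset.range_add_one, Finset.filter_insert, hj]
        rw [e, Finset.range_add_one, Finset.filter_insert, if_pos hj,
          Finset.sum_insert (by simp)]
        -- The increment `2 c + 1` is at most `3 c` only for `c ≥ 1`; the first element of `S` is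
        -- paid for by the `+ 1`.
        rcases Nat.eq_zero_or_pos (c j) with h0 | h0
        · rw [h0]; omega
        · nlinarith
      · have e : c (j + 1) = c j := by simp [hc, Finset.range_add_one, Finset.filter_insert, hj]
        rwa [e, Finset.range_add_one, Finset.filter_insert, if_neg hj]
  have hle : ∀ j, (c j : ℝ≥0∞) ^ 2 ≤ 3 * T + 1 := by
    intro j
    have h1 : ((∑ n ∈ Finset.range j with n ∈ S, c n : ℕ) : ℝ≥0∞) ≤ T := by
      push_cast
      rw [hT, tsum_subtype S fun n => (c n : ℝ≥0∞), Finset.sum_filter]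
      refine le_trans (le_of_eq ?_) (ENNReal.sum_le_tsum (Finset.range j))
      exact Finset.sum_congr rfl fun n _ => by simp [Set.indicator_apply]
    calc (c j : ℝ≥0∞) ^ 2 = ((c j ^ 2 : ℕ) : ℝ≥0∞) := by push_cast; rfl
      _ ≤ ((3 * ∑ n ∈ Finset.range j with n ∈ S, c n + 1 : ℕ) : ℝ≥0∞) := by exact_mod_cast hnat j
      _ = 3 * ((∑ n ∈ Finset.range j with n ∈ S, c n : ℕ) : ℝ≥0∞) + 1 := by
        rw [Nat.cast_add, Nat.cast_mul]; norm_num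
      _ ≤ 3 * T + 1 := by gcongr
  have hsup : (S.encard : ℝ≥0∞) ≤ (3 * T + 1) ^ (1 / 2 : ℝ) := by
    have e : (S.encard : ℝ≥0∞) = ∑' n : S, 1 := by rw [ENNReal.tsum_set_const, mul_one]
    rw [e, tsum_subtype S fun _ => (1 : ℝ≥0∞), ENNReal.tsum_eq_iSup_nat]
    refine iSup_le fun j => ?_
    have e2 : ∑ n ∈ Finset.range j, S.indicator (fun _ => (1 : ℝ≥0∞)) n = c j := by
      simp [Set.indicator_apply, hc]
    rw [e2]
    have := ENNReal.rpow_le_rpow (hle j) (by norm_num : (0 : ℝ) ≤ 1 / 2)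
    rw [← ENNReal.rpow_natCast, ← ENNReal.rpow_mul] at this
    simpa using this
  calc (S.encard : ℝ≥0∞) ^ 2 ≤ ((3 * T + 1) ^ (1 / 2 : ℝ)) ^ 2 := by gcongr
    _ = 3 * T + 1 := by rw [← ENNReal.rpow_natCast, ← ENNReal.rpow_mul]; norm_num

lemma ENNReal.sum_sq_le {J : Type*} [Fintype J] (x : J → ℝ≥0∞) :
    (∑ j, x j) ^ 2 ≤ 2 * Fintype.card J * ∑ j, x j ^ 2 := by
  rw [sq, Finset.sum_mul_sum]
  calc ∑ i, ∑ j, x i * x j ≤ ∑ i, ∑ j, (x i ^ 2 + x j ^ 2) :=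
        Finset.sum_le_sum fun i _ => Finset.sum_le_sum fun j _ => ENNReal.mul_le_sq_add_sq _ _
    _ = _ := by
        simp only [Finset.sum_add_distrib, Finset.sum_const, Finset.card_univ, nsmul_eq_mul,
          ← Finset.mul_sum]
        ring

/-- Refining the dyadic shells into boundedly many parts, the pairs in the same part still
control `weakSum`. -/
lemma weakSum_ne_top_of_refinement {d : ℕ} {r : ℕ → Fin d → Set.Ico (0 : ℝ) 1} {J : Type*}
    [Fintype J] [DecidableEq J] (t : ℕ → J)
    (h : ∑' n, (((Finset.range n).filter fun k =>
      (shellMultiIndex r k, t k) = (shellMultiIndex r n, t n)).card : ℝ≥0∞) *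
        2⁻¹ ^ (∑ i, shellMultiIndex r n i) ≠ ∞) :
    weakSum r ≠ ∞ := by
  set s : ℕ → (Fin d → ℕ) × J := fun n => (shellMultiIndex r n, t n) with hs
  set c : ℕ → ℝ≥0∞ := fun n => (((Finset.range n).filter fun k => s k = s n).card : ℝ≥0∞) with hc
  set b : (Fin d → ℕ) → ℝ≥0∞ := fun m => 2⁻¹ ^ (∑ i, m i) with hb
  set T : (Fin d → ℕ) → J → ℝ≥0∞ := fun m j => ∑' n : s ⁻¹' {(m, j)}, c n with hT
  set q : ℝ≥0∞ := (Fintype.card J : ℝ≥0∞) with hq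
  have hq' : q ≠ ∞ := by simp [hq]
  have hN : ∀ m, (shellCount r m : ℝ≥0∞) ^ 2 ≤ 2 * q * ∑ j, (3 * T m j + 1) := by
    intro m
    have h1 : (shellCount r m : ℝ≥0∞) ≤ ∑ j, ((s ⁻¹' {(m, j)}).encard : ℝ≥0∞) := by
      have e : shellMultiIndex r ⁻¹' {m} = ⋃ j, s ⁻¹' {(m, j)} := by
        ext n; simp [hs]
      rw [shellCount_eq_encard_preimage, e, ← mul_one ((Set.encard _ : ℕ∞) : ℝ≥0∞),
        ← ENNReal.tsum_set_const]
      refine (ENNReal.tsum_iUnion_le (fun _ => 1) _).trans_eq ?_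
      exact Finset.sum_congr rfl fun j _ => by rw [ENNReal.tsum_set_const, mul_one]
    refine (pow_le_pow_left' h1 2).trans ((ENNReal.sum_sq_le _).trans ?_)
    gcongr with j
    have : DecidablePred (· ∈ s ⁻¹' {(m, j)}) := fun n => decEq (s n) (m, j)
    refine (encard_sq_le (s ⁻¹' {(m, j)})).trans_eq ?_
    congr 2
    refine tsum_congr fun n => ?_
    have hn : s n = (m, j) := n.2
    simp only [hc, hn]
    exact congrArg (fun a : ℕ => (a : ℝ≥0∞))
      (congrArg Finset.card (Finset.filter_congr fun k _ => Iff.rfl))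
  have hTsum : ∑' m, ∑' j, T m j * b m = ∑' n, c n * b (shellMultiIndex r n) := by
    rw [← ENNReal.tsum_prod (f := fun m j => T m j * b m),
      ← ENNReal.tsum_fiberwise (fun n => c n * b (shellMultiIndex r n)) s]
    refine tsum_congr fun x => ?_
    rw [hT, ← ENNReal.tsum_mul_right]
    refine tsum_congr fun n => ?_
    have hn : s n = x := n.2
    change _ = c n * b (s n).1
    rw [hn]
  -- This absorbs the additive constants of `encard_sq_le`, one for each shell and part.
  have hbsum : ∑' m, b m ≠ ∞ :=
    tsum_pow_sum_ne_top (ENNReal.inv_lt_one.2 (by norm_num))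
  have hle : weakSum r ≤ 2 * q * (3 * ∑' m, ∑' j, T m j * b m + q * ∑' m, b m) := by
    rw [← ENNReal.tsum_mul_left, ← ENNReal.tsum_mul_left, ← ENNReal.tsum_add,
      ← ENNReal.tsum_mul_left]
    refine ENNReal.tsum_le_tsum fun m => ?_
    refine (mul_le_mul_left (hN m) (b m)).trans_eq ?_
    rw [Finset.sum_add_distrib, tsum_fintype, ← Finset.sum_mul, ← Finset.mul_sum]
    simp only [Finset.sum_const, Finset.card_univ, nsmul_eq_mul, mul_one]
    ring
  refine ne_top_of_le_ne_top ?_ hle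
  rw [hTsum]
  refine ENNReal.mul_ne_top (ENNReal.mul_ne_top (by norm_num) hq') (ENNReal.add_ne_top.2
    ⟨ENNReal.mul_ne_top (by norm_num) h, ENNReal.mul_ne_top hq' hbsum⟩)

end PairCount

/-! ### Cells of small diameter and failure of weak separation. -/

section Cells

variable {d : ℕ} {r : ℕ → Fin d → Set.Ico (0 : ℝ) 1}

/-- The index of the cell of `x` in the division of the circle into `L` equal arcs. -/
noncomputable def arcIndex (L : ℕ) (x : ℝ) : ℤ := ⌊L * x / (2 * Real.pi)⌋

lemma measurable_arcIndex (L : ℕ) : Measurable (arcIndex L) := by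
  unfold arcIndex
  fun_prop

lemma angleLaw_arcIndex_preimage {L : ℕ} (hL : 0 < L) {Q : ℤ} (hQ : Q ∈ Finset.Ico (0 : ℤ) L) :
    angleLaw (arcIndex L ⁻¹' {Q}) = ENNReal.ofReal (L : ℝ)⁻¹ := by
  have hπ := Real.pi_pos
  have hL' : (0 : ℝ) < L := by exact_mod_cast hL
  rw [Finset.mem_Ico] at hQ
  have hQ0 : (0 : ℝ) ≤ Q := by exact_mod_cast hQ.1
  have hQ1 : (Q : ℝ) + 1 ≤ L := by exact_mod_cast hQ.2
  have e : arcIndex L ⁻¹' {Q} ∩ Set.Ico 0 (2 * Real.pi) =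
      Set.Ico (Q * (2 * Real.pi / L)) ((Q + 1) * (2 * Real.pi / L)) := by
    ext x
    have h1 : arcIndex L x = Q ↔ Q * (2 * Real.pi / L) ≤ x ∧ x < (Q + 1) * (2 * Real.pi / L) := by
      rw [arcIndex, Int.floor_eq_iff, le_div_iff₀ (by positivity), div_lt_iff₀ (by positivity),
        mul_div_assoc', mul_div_assoc', div_le_iff₀ hL', lt_div_iff₀ hL', mul_comm x]
    simp only [Set.mem_inter_iff, Set.mem_preimage, Set.mem_singleton_iff, h1, Set.mem_Ico,
      and_iff_left_iff_imp]
    rintro ⟨h2, h3⟩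
    refine ⟨le_trans (by positivity) h2, h3.trans_le ?_⟩
    rw [mul_div_assoc', div_le_iff₀ hL']
    nlinarith
  rw [angleLaw_apply, Measure.restrict_apply (measurable_arcIndex L (measurableSet_singleton Q)), e,
    Real.volume_Ico, ← ENNReal.ofReal_inv_of_pos (by positivity),
    ← ENNReal.ofReal_mul (by positivity)]
  congr 1
  field_simp
  ring

lemma ae_angleLaw_arcIndex_mem {L : ℕ} (hL : 0 < L) :
    ∀ᵐ x ∂angleLaw, arcIndex L x ∈ Finset.Ico (0 : ℤ) L := by
  have hπ := Real.pi_pos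
  have hL' : (0 : ℝ) < L := by exact_mod_cast hL
  refine Measure.ae_smul_measure ?_ _
  filter_upwards [ae_restrict_mem measurableSet_Ico] with x hx
  rw [Finset.mem_Ico, arcIndex]
  refine ⟨Int.floor_nonneg.2 (div_nonneg (mul_nonneg hL'.le hx.1) (by positivity)), ?_⟩
  rw [Int.floor_lt, div_lt_iff₀ (by positivity)]
  push_cast
  exact mul_lt_mul_of_pos_left hx.2 hL'

/-- The radial position, up to `2^{-m}/K`, of a point inside its dyadic shell. -/
noncomputable def radialIndex (K : ℕ) (x : Set.Ico (0 : ℝ) 1) : Fin (K + 1) :=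
  ⟨⌊K * ((1 - (x : ℝ)) * 2 ^ shellIndex x)⌋₊, by
    have h := one_sub_le_of_shellIndex x
    have h1 : (1 - (x : ℝ)) * 2 ^ shellIndex x ≤ 1 := by
      rw [inv_pow] at h
      calc _ ≤ ((2 : ℝ) ^ shellIndex x)⁻¹ * 2 ^ shellIndex x := by gcongr
        _ = 1 := inv_mul_cancel₀ (by positivity)
    rw [Nat.lt_succ_iff]
    refine Nat.floor_le_of_le ?_
    exact mul_le_of_le_one_right (Nat.cast_nonneg K) h1⟩

lemma abs_sub_le_of_radialIndex_eq {K : ℕ} (hK : 0 < K) {x y : Set.Ico (0 : ℝ) 1}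
    (h1 : shellIndex x = shellIndex y) (h2 : radialIndex K x = radialIndex K y) :
    |(x : ℝ) - y| ≤ (2 : ℝ)⁻¹ ^ shellIndex x / K := by
  have hK' : (0 : ℝ) < K := by exact_mod_cast hK
  have hx : 0 ≤ 1 - (x : ℝ) := by linarith [x.2.2]
  have hy : 0 ≤ 1 - (y : ℝ) := by linarith [y.2.2]
  have hfl := congrArg Fin.val h2
  simp only [radialIndex, ← h1] at hfl
  set M : ℝ := 2 ^ shellIndex x with hM
  have hM0 : 0 < M := by positivity
  have ha := Nat.floor_le (mul_nonneg hK'.le (mul_nonneg hx hM0.le))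
  have hb := Nat.lt_floor_add_one (K * ((1 - (x : ℝ)) * M))
  have hc := Nat.floor_le (mul_nonneg hK'.le (mul_nonneg hy hM0.le))
  have hd := Nat.lt_floor_add_one (K * ((1 - (y : ℝ)) * M))
  rw [← hfl] at hc hd
  have e : (2 : ℝ)⁻¹ ^ shellIndex x = M⁻¹ := inv_pow _ _
  rw [e, inv_eq_one_div, div_div, le_div_iff₀ (by positivity), ← abs_of_pos hM0,
    ← abs_of_pos hK', ← abs_mul, ← abs_mul, abs_le]
  constructor <;> linarith

lemma abs_sub_le_of_arcIndex_eq {L : ℕ} (hL : 0 < L) {x y : ℝ} (h : arcIndex L x = arcIndex L y) :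
    |x - y| ≤ 2 * Real.pi / L := by
  have hπ := Real.pi_pos
  have hL' : (0 : ℝ) < L := by exact_mod_cast hL
  have h1 := Int.abs_sub_lt_one_of_floor_eq_floor h
  have e : L * x / (2 * Real.pi) - L * y / (2 * Real.pi) = (x - y) * (L / (2 * Real.pi)) := by ring
  rw [e, abs_mul, abs_of_pos (a := (L : ℝ) / (2 * Real.pi)) (by positivity),
    ← lt_div_iff₀ (by positivity), one_div_div] at h1
  exact h1.le

lemma norm_ofReal_mul_exp_sub_le {a b x y : ℝ} (hb0 : 0 ≤ b) (hb1 : b ≤ 1) :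
    ‖(a : ℂ) * Complex.exp (x * Complex.I) - b * Complex.exp (y * Complex.I)‖ ≤
      |a - b| + |x - y| := by
  have e : (a : ℂ) * Complex.exp (x * Complex.I) - b * Complex.exp (y * Complex.I) =
      ((a - b : ℝ) : ℂ) * Complex.exp (x * Complex.I) +
      b * Complex.exp (y * Complex.I) * (Complex.exp (Complex.I * (x - y : ℝ)) - 1) := by
    have h : Complex.exp (x * Complex.I) =
        Complex.exp (y * Complex.I) * Complex.exp (Complex.I * (x - y : ℝ)) := by
      rw [← Complex.exp_add]; congr 1; push_cast; ring
    push_cast at h ⊢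
    linear_combination (b : ℂ) * h
  rw [e]
  refine (norm_add_le _ _).trans ?_
  have h1 := Real.norm_exp_I_mul_ofReal_sub_one_le (x := x - y)
  simp only [norm_mul, Complex.norm_exp_ofReal_mul_I, mul_one, Complex.norm_real, Real.norm_eq_abs,
    abs_of_nonneg hb0] at h1 ⊢
  have := mul_le_mul hb1 h1 (norm_nonneg _) zero_le_one
  linarith

/-- Radial layer and arc both have size `O(2^{-m}/K)` in a coordinate of shell index `m`, while the
denominator of the pseudo-hyperbolic distance is at least `1 - r ≥ 2^{-(m+1)}`; the scale `2^{-m}`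
cancels. -/
lemma gleasonDist_le_of_cell_eq {K : ℕ} (hK : 0 < K) {φ : ℕ → Fin d → ℝ} {n k : ℕ}
    (hs : shellMultiIndex r n = shellMultiIndex r k)
    (hrad : ∀ i, radialIndex K (r n i) = radialIndex K (r k i))
    (harc : ∀ i, arcIndex (K * 2 ^ shellMultiIndex r n i) (φ n i) =
      arcIndex (K * 2 ^ shellMultiIndex r n i) (φ k i)) :
    gleasonDist (polarSequence r φ n) (polarSequence r φ k) ≤ 2 * (1 + 2 * Real.pi) / K := by
  have hπ := Real.pi_pos
  have hK' : (0 : ℝ) < K := by exact_mod_cast hK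
  refine Real.iSup_le (fun i => ?_) (by positivity)
  have hsi : shellIndex (r n i) = shellIndex (r k i) := congrFun hs i
  set m := shellIndex (r n i) with hm
  have h1 := abs_sub_le_of_radialIndex_eq hK hsi (hrad i)
  have h2 := abs_sub_le_of_arcIndex_eq (by positivity) (harc i)
  have h3 := norm_ofReal_mul_exp_sub_le (a := r n i) (x := φ n i) (y := φ k i) (r k i).2.1
    (r k i).2.2.le
  have h4 : (2 : ℝ)⁻¹ ^ (m + 1) ≤
      ‖1 - conj ((polarSequence r φ n).1 i) * (polarSequence r φ k).1 i‖ := by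
    have h5 := norm_sub_norm_le (1 : ℂ) (conj ((polarSequence r φ n).1 i) *
      (polarSequence r φ k).1 i)
    rw [norm_one, norm_mul, RCLike.norm_conj, norm_polarSequence, norm_polarSequence] at h5
    have h6 := lt_one_sub_of_shellIndex (r n i)
    have h7 : (r n i : ℝ) * r k i ≤ r n i := mul_le_of_le_one_right (r n i).2.1 (r k i).2.2.le
    linarith
  have h8 : ‖(polarSequence r φ n).1 i - (polarSequence r φ k).1 i‖ ≤
      (1 + 2 * Real.pi) / K * (2 : ℝ)⁻¹ ^ m := by
    have e : 2 * Real.pi / ((K * 2 ^ shellMultiIndex r n i : ℕ) : ℝ) =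
        2 * Real.pi / K * (2 : ℝ)⁻¹ ^ m := by
      have : shellMultiIndex r n i = m := rfl
      rw [this, inv_pow]; push_cast; field_simp
    rw [e] at h2
    have e2 : (1 + 2 * Real.pi) / K * (2 : ℝ)⁻¹ ^ m =
        (2 : ℝ)⁻¹ ^ m / K + 2 * Real.pi / K * (2 : ℝ)⁻¹ ^ m := by ring
    rw [e2]
    exact h3.trans (add_le_add h1 h2)
  rw [pseudoHyperbolicDist, norm_div, div_le_iff₀ (lt_of_lt_of_le (by positivity) h4)]
  have h9 := mul_le_mul_of_nonneg_left h4 (by positivity : 0 ≤ 2 * (1 + 2 * Real.pi) / K)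
  refine h8.trans (le_trans (le_of_eq ?_) h9)
  rw [pow_succ]; ring

variable {Ω : Type*} [MeasurableSpace Ω] {P : Measure Ω} [IsProbabilityMeasure P]
  {θ : ℕ → Ω → Fin d → ℝ}

/-- The label is the shell with its radial layer, the random value the box of arcs. The number of
arcs depends on the shell only, so each box has probability `K^{-d} 2^{-|m|}`. With `K` fixed, the
factor `K^{-d}` does not affect divergence. -/
lemma ae_exists_gleasonDist_le (hmeas : ∀ n, Measurable (θ n)) (hindep : iIndepFun θ P)
    (hlaw : ∀ n, P.map (θ n) = Measure.pi fun _ => angleLaw) (h : weakSum r = ∞)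
    {K : ℕ} (hK : 0 < K) :
    ∀ᵐ ω ∂P, ∃ n k, n ≠ k ∧ gleasonDist (polarSequence r (fun n => θ n ω) n)
      (polarSequence r (fun n => θ n ω) k) ≤ 2 * (1 + 2 * Real.pi) / K := by
  set L : (Fin d → ℕ) → Fin d → ℕ := fun m i => K * 2 ^ m i with hL
  have hL0 : ∀ m i, 0 < L m i := fun m i => by positivity
  set s : ℕ → (Fin d → ℕ) × (Fin d → Fin (K + 1)) := fun n =>
    (shellMultiIndex r n, fun i => radialIndex K (r n i)) with hs
  set g : ℕ → (Fin d → ℝ) → (Fin d → ℤ) := fun n x i =>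
    arcIndex (L (shellMultiIndex r n) i) (x i) with hg
  have hgm : ∀ n, Measurable (g n) := fun n => measurable_pi_lambda _ fun i =>
    (measurable_arcIndex _).comp (measurable_pi_apply i)
  set B : (Fin d → ℕ) × (Fin d → Fin (K + 1)) → Finset (Fin d → ℤ) := fun a =>
    Fintype.piFinset fun i => Finset.Ico (0 : ℤ) (L a.1 i) with hB
  set p : (Fin d → ℕ) × (Fin d → Fin (K + 1)) → ℝ := fun a => ∏ i, ((L a.1 i : ℕ) : ℝ)⁻¹ with hp
  have hp0 : ∀ a, 0 ≤ p a := fun a => Finset.prod_nonneg fun i _ => by positivity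
  have hBmem : ∀ n, ∀ᵐ ω ∂P, g n (θ n ω) ∈ B (s n) := by
    intro n
    refine ae_of_ae_map (hmeas n).aemeasurable (p := fun x => g n x ∈ B (s n)) ?_
    rw [hlaw n]
    have h1 : ∀ i, ∀ᵐ x ∂(Measure.pi fun _ : Fin d => angleLaw),
        arcIndex (L (shellMultiIndex r n) i) (x i) ∈
          Finset.Ico (0 : ℤ) (L (shellMultiIndex r n) i) := fun i =>
      (measurePreserving_eval (fun _ : Fin d => angleLaw) i).quasiMeasurePreserving.ae
        (ae_angleLaw_arcIndex_mem (hL0 _ i))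
    filter_upwards [ae_all_iff.2 h1] with x hx
    exact Fintype.mem_piFinset.2 hx
  have hprob : ∀ n, ∀ Q ∈ B (s n), P.real ((fun ω => g n (θ n ω)) ⁻¹' {Q}) = p (s n) := by
    intro n Q hQ
    have e1 : P ((fun ω => g n (θ n ω)) ⁻¹' {Q}) = P.map (θ n) (g n ⁻¹' {Q}) :=
      (Measure.map_apply (hmeas n) (hgm n (measurableSet_singleton Q))).symm
    have e2 : g n ⁻¹' {Q} =
        Set.univ.pi fun i => arcIndex (L (shellMultiIndex r n) i) ⁻¹' {Q i} := by
      ext x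
      simp [hg, funext_iff]
    rw [measureReal_def, e1, e2, hlaw n, Measure.pi_pi, ENNReal.toReal_prod]
    refine Finset.prod_congr rfl fun i _ => ?_
    rw [angleLaw_arcIndex_preimage (hL0 _ i) (Fintype.mem_piFinset.1 hQ i),
      ENNReal.toReal_ofReal (by positivity)]
  have hsum : ¬ Summable fun n =>
      (((Finset.range n).filter fun k => s k = s n).card : ℝ) * p (s n) := by
    intro hsum
    refine weakSum_ne_top_of_refinement (r := r) (fun n i => radialIndex K (r n i)) ?_ h
    have h1 := hsum.tsum_ofReal_ne_top
    have e : ∀ n, (((Finset.range n).filter fun k => s k = s n).card : ℝ≥0∞) *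
        2⁻¹ ^ (∑ i, shellMultiIndex r n i) = (K : ℝ≥0∞) ^ d * ENNReal.ofReal
          ((((Finset.range n).filter fun k => s k = s n).card : ℝ) * p (s n)) := by
      intro n
      have e1 : p (s n) = ((K : ℝ) ^ d)⁻¹ * 2⁻¹ ^ (∑ i, shellMultiIndex r n i) := by
        simp only [hp, hs, hL]
        push_cast
        simp only [mul_inv, Finset.prod_mul_distrib, Finset.prod_const, Finset.card_univ,
          Fintype.card_fin, ← inv_pow, Finset.prod_pow_eq_pow_sum]
      have hK1 : (K : ℝ≥0∞) ^ d ≠ 0 := by positivity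
      have hK2 : (K : ℝ≥0∞) ^ d ≠ ∞ := ENNReal.pow_ne_top (ENNReal.natCast_ne_top K)
      have e2 : ENNReal.ofReal (p (s n)) =
          ((K : ℝ≥0∞) ^ d)⁻¹ * 2⁻¹ ^ (∑ i, shellMultiIndex r n i) := by
        rw [e1, ENNReal.ofReal_mul (by positivity), ENNReal.ofReal_inv_of_pos (by positivity),
          ENNReal.ofReal_pow (by positivity), ENNReal.ofReal_natCast,
          ENNReal.ofReal_pow (by positivity), ENNReal.ofReal_inv_of_pos (by positivity),
          ENNReal.ofReal_ofNat]
      rw [ENNReal.ofReal_mul (by positivity), ENNReal.ofReal_natCast, e2, mul_left_comm,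
        ← mul_assoc ((K : ℝ≥0∞) ^ d), ENNReal.mul_inv_cancel hK1 hK2, one_mul]
    rw [tsum_congr e, ENNReal.tsum_mul_left]
    exact ENNReal.mul_ne_top (ENNReal.pow_ne_top (ENNReal.natCast_ne_top K)) h1
  have hcoll := ae_exists_collision (fun n => (hgm n).comp (hmeas n)) (hindep.comp g hgm) hBmem
    hprob (fun n => hp0 _) hsum
  filter_upwards [hcoll] with ω hω
  obtain ⟨j, k, hkj, hskj, hX⟩ := hω
  refine ⟨k, j, hkj.ne, gleasonDist_le_of_cell_eq hK (congrArg Prod.fst hskj)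
    (fun i => congrFun (congrArg Prod.snd hskj) i) fun i => ?_⟩
  have h1 : shellMultiIndex r k = shellMultiIndex r j := congrArg Prod.fst hskj
  have h2 := congrFun hX i
  simp only [Function.comp_apply, hg, ← h1] at h2
  exact h2

lemma ae_not_weaklySeparated (hmeas : ∀ n, Measurable (θ n)) (hindep : iIndepFun θ P)
    (hlaw : ∀ n, P.map (θ n) = Measure.pi fun _ => angleLaw) (h : weakSum r = ∞) :
    ∀ᵐ ω ∂P, ¬ WeaklySeparated (polarSequence r fun n => θ n ω) := by
  filter_upwards [ae_all_iff.2 fun K : ℕ =>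
    ae_exists_gleasonDist_le hmeas hindep hlaw h K.succ_pos] with ω hω
  rintro ⟨δ, hδ, hsep⟩
  obtain ⟨K, hK⟩ := exists_nat_gt (2 * (1 + 2 * Real.pi) / δ)
  obtain ⟨n, k, hnk, hle⟩ := hω K
  have hK1 : 2 * (1 + 2 * Real.pi) / δ < ((K.succ : ℕ) : ℝ) := hK.trans (by simp)
  have h1 : 2 * (1 + 2 * Real.pi) / ((K.succ : ℕ) : ℝ) < δ := by
    rw [div_lt_iff₀ (by positivity)]
    rw [div_lt_iff₀ hδ] at hK1
    linarith
  exact absurd (hsep n k hnk) (not_le.2 (hle.trans_lt h1))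

end Cells

/-! ### Conclusion. -/

lemma uniformlySeparated_of_tsum_coordDefect_rpow_ne_top {d : ℕ} (hd : 1 ≤ d)
    {Z : ℕ → Polydisc d} (hinj : ∀ n k, n ≠ k → Z n ≠ Z k) {α : ℝ} (hα : 0 ≤ α)
    (hdα : d * α ≤ 1)
    (h : ∑' n, ∑' k, (if n = k then 0 else ∏ i, coordDefect (Z n) (Z k) i ^ α) ≠ ∞) :
    UniformlySeparated Z := by
  have hle : ∀ n k, ENNReal.ofReal (1 - gleasonDist (Z n) (Z k) ^ 2) ≤
      ∏ i, coordDefect (Z n) (Z k) i ^ α := fun n k =>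
    ofReal_one_sub_gleasonDist_sq_le _ _ hα hdα
  refine uniformlySeparated_of_tsum_ne_top (weaklySeparated_of_tsum_ne_top hinj h ?_) ?_
  · intro n k hnk
    rw [if_neg hnk]
    have h1 : ENNReal.ofReal (1 - gleasonDist (Z n) (Z k) ^ 2) ≤ 1 :=
      ENNReal.ofReal_le_one.2 (by linarith [sq_nonneg (gleasonDist (Z n) (Z k))])
    exact (pow_le_of_le_one zero_le h1 (by omega)).trans (hle n k)
  · refine ne_top_of_le_ne_top h (ENNReal.tsum_le_tsum fun n => ENNReal.tsum_le_tsum fun k => ?_)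
    split_ifs
    · exact le_rfl
    · exact hle n k

theorem theorem1p3 {d : ℕ} (hd : 1 ≤ d)
    {Ω : Type*} [MeasurableSpace Ω] (P : Measure Ω) [IsProbabilityMeasure P]
    (r : ℕ → Fin d → Set.Ico (0 : ℝ) 1) (θ : ℕ → Ω → Fin d → ℝ)
    (hmeas : ∀ n, Measurable (θ n))
    (hindep : iIndepFun θ P)
    (hunif : ∀ n, pdf.IsUniform (θ n)
      (Set.univ.pi fun _ : Fin d => Set.Ico 0 (2 * Real.pi)) P volume) :
    -- (i) weak separation; at most one of the radii vectors is zero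
    ((weakSum r < ∞ → {n : ℕ | ∀ i, (r n i : ℝ) = 0}.Subsingleton →
        ∀ᵐ ω ∂P, WeaklySeparated (polarSequence r fun n => θ n ω)) ∧
      (weakSum r = ∞ →
        ∀ᵐ ω ∂P, ¬ WeaklySeparated (polarSequence r fun n => θ n ω))) ∧
    -- (ii) uniform separation; at most one of the radii vectors is zero
    (strongSum r < ∞ → {n : ℕ | ∀ i, (r n i : ℝ) = 0}.Subsingleton →
        ∀ᵐ ω ∂P, UniformlySeparated (polarSequence r fun n => θ n ω)) ∧
    -- (iii) Carleson measures
    (weakSum r < ∞ →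
        ∀ᵐ ω ∂P, IsCarlesonMeasure (HardySpace d)
          (sequenceMeasure (polarSequence r fun n => θ n ω))) := by
  have hlaw : ∀ n, P.map (θ n) = Measure.pi fun _ => angleLaw := fun n =>
    map_eq_pi_angleLaw (hunif n)
  refine ⟨⟨fun h hr => ?_, ae_not_weaklySeparated hmeas hindep hlaw⟩, fun h hr => ?_, fun h => ?_⟩
  · filter_upwards [ae_tsum_coordDefect_ne_top hmeas hindep hlaw h.ne,
      ae_polarSequence_injective hmeas hindep hlaw hr] with ω hω hinj
    refine weaklySeparated_of_tsum_ne_top hinj hω fun n k hnk => ?_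
    rw [if_neg hnk]
    refine le_trans (le_of_eq (by simp)) (Finset.prod_le_prod' fun i (_ : i ∈ Finset.univ) =>
      ofReal_one_sub_gleasonDist_sq_le_coordDefect _ _ i)
  · rcases hd.eq_or_lt with rfl | hd2
    -- For `d = 1` the range `α > 1/2` is incompatible with the integrability condition `α < 1/2`,
    -- so the first-moment bound with `α = 1` replaces it.
    · rw [strongSum_eq_weakSum] at h
      filter_upwards [ae_tsum_coordDefect_ne_top hmeas hindep hlaw h.ne,
        ae_polarSequence_injective hmeas hindep hlaw hr] with ω hω hinj
      refine uniformlySeparated_of_tsum_coordDefect_rpow_ne_top hd hinj zero_le_one (by simp) ?_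
      simpa only [ENNReal.rpow_one] using hω
    · have hd0 : (2 : ℝ) ≤ d := by exact_mod_cast hd2
      -- `α > 1/(d+1)` is for summability over shells, `α < 1/d` for the comparison with `ρ_G`; as
      -- `d ≥ 2`, also `α < 1/2`.
      obtain ⟨α, hα1, hα2⟩ := exists_between
        (one_div_lt_one_div_of_lt (by linarith) (lt_add_one (d : ℝ)))
      have hα3 : α < 1 / 2 := hα2.trans_le (one_div_le_one_div_of_le (by norm_num) hd0)
      filter_upwards [ae_tsum_coordDefect_rpow_ne_top_of_strongSum hd hmeas hindep hlaw h.ne hα1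
        hα3, ae_polarSequence_injective hmeas hindep hlaw hr] with ω hω hinj
      refine uniformlySeparated_of_tsum_coordDefect_rpow_ne_top hd hinj
        (le_trans (by positivity) hα1.le) ?_ hω
      rw [lt_div_iff₀ (by linarith)] at hα2
      linarith
  · filter_upwards [ae_tsum_coordDefect_ne_top hmeas hindep hlaw h.ne] with ω hω
    exact isCarlesonMeasure_sequenceMeasure hω
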